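/- **Definitions.** Fix a dimension $D\in\mathbb{N}$. A *$D$-VASS* is a finite directed multigraph $G=(Q,T)$ (loops and parallel edges allowed) whose edges $e$ carry labels $\mathbf{t}_e\in\mathbb{Z}^D$. The displacement $\Delta(\pi)$ of a path $\pi$ is the sum of its labels, and $\Delta(\psi)=\sum_e\psi(e)\mathbf{t}_e$ for $\psi\in\mathbb{N}^T$. A path $\pi$ started at a location $\mathbf{r}\in\mathbb{Z}^D$ visits the locations $\mathbf{r}+\Delta(\pi')$, $\pi'$ a prefix of $\pi$. For $I\subseteq\{1,\dots,D\}$ it is an *$I$-walk* if all these locations have nonnegative entries at all indices in $I$, and a *walk* if they all lie in $\mathbb{N}^D$. A *constraint graph sequence* (CGS) $\Xi$ consists of components $\Xi_j=p_jG_jq_j$ for $0\le j\le k$, where $G_j=(Q_j,T_j)$ is a strongly connected $D$-VASS with an entry state $p_j$ and an exit state $q_j$, and of connecting edges $q_{j-1}\xrightarrow{\mathbf{t}_j}p_j$ for $1\le j\le k$. For $\mathbf{a},\mathbf{b}\in\mathbb{N}^D$, the size $|\mathbf{a}\Xi\mathbf{b}|$ is the length of the binary encoding. A *witness* to $\mathbf{a}\Xi\mathbf{b}$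 is a walk of the form $$p_0(\mathbf{a}_0)\to^*q_0(\mathbf{b}_0)\xrightarrow{\mathbf{t}_1}p_1(\mathbf{a}_1)\to^*\cdots\xrightarrow{\mathbf{t}_k}p_k(\mathbf{a}_k)\to^*q_k(\mathbf{b}_k),\qquad \mathbf{a}_0=\mathbf{a},\ \mathbf{b}_k=\mathbf{b},$$ whose part from $p_j$ to $q_j$ lies inside $G_j$; its length is its number of edges. The component $\Xi_j$ is *linear* if $p_j=q_j$, $G_j$ has at least one edge, and every vertex of $G_j$ has exactly one incoming and exactly one outgoing edge; its *lap* is the closed path $\mathrm{O}_j$ from $p_j$ that passes every edge exactly once. The *characteristic system* $\mathcal{E}$ has the unknowns $\mathbf{x}_j,\mathbf{y}_j\in\mathbb{N}^D$ and $\Psi_j\in\mathbb{N}^{T_j}$, for $0\le j\le k$, and the constraints $\mathbf{x}_0=\mathbf{a}$, $\mathbf{y}_k=\mathbf{b}$, $\mathbf{y}_{j-1}+\mathbf{t}_j=\mathbf{x}_j$ for $1\le j\le k$, and, for all $j$, $$\sum_{e:p'\to q'\in T_j}\Psi_j(e)(\mathbf{1}_{q'}-\mathbf{1}_{p'})=\mathbf{1}_{q_j}-\mathbf{1}_{p_j},\qquad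 \Psi_j(e)>0\ (e\in T_j),\qquad \mathbf{x}_j+\Delta(\Psi_j)=\mathbf{y}_j;$$ moreover, for each linear $\Xi_j$, the first and the last lap stay in $\mathbb{N}^D$: the lap $\mathrm{O}_j$ is a walk when started at $\mathbf{x}_j$, and also when started at $\mathbf{x}_j+(\Psi_j(e)-1)\Delta(\mathrm{O}_j)$ for $e\in T_j$. The *homogeneous system* $\mathcal{E}^0$ consists of $\mathbf{x}_0=\mathbf{0}$, $\mathbf{y}_k=\mathbf{0}$, $\mathbf{y}_{j-1}=\mathbf{x}_j$ for $1\le j\le k$, and, for all $j$, $\sum_{e}\Psi_j(e)(\mathbf{1}_{q'}-\mathbf{1}_{p'})=\mathbf{0}$ and $\mathbf{x}_j+\Delta(\Psi_j)=\mathbf{y}_j$; the zero assignment does not count as a solution of $\mathcal{E}^0$. Let $\mathcal{H}(\mathcal{E})$ and $\mathcal{H}(\mathcal{E}^0)$ be the sets of solutions that are minimal in the pointwise order, and let $\mathbf{O}=\sum_{\mathbf{o}\in\mathcal{H}(\mathcal{E}^0)}\mathbf{o}$. An index $i$ is *bounded at $p_j$* (*at $q_j$*) if $\mathbf{x}_j^{\mathbf{O}}(i)=0$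 ($\mathbf{y}_j^{\mathbf{O}}(i)=0$). The component $\Xi_j$ is *unbounded* if $\Psi_j^{\mathbf{O}}(e)>0$ for all $e\in T_j$. An index $i$ is *orthogonal* to $G_j$ if $\Delta(\mathrm{o})(i)=0$ for every simple cycle $\mathrm{o}$ of $G_j$. Let $\iota(p_j)$ (respectively $\iota(q_j)$) be the set of the indices that are bounded at $p_j$ (at $q_j$) and not orthogonal to $G_j$. Let $\mathbf{n}$ be a solution of $\mathcal{E}$. The component $\Xi_j$ is *$\mathbf{n}$-pumpable* if there are an $\iota(p_j)$-walk $p_j(\mathbf{x}_j^{\mathbf{n}})\to^*p_j(\mathbf{r})$ inside $G_j$ with $\mathbf{r}(i)\ge\mathbf{x}_j^{\mathbf{n}}(i)+1$ for all $i\in\iota(p_j)$, and an $\iota(q_j)$-walk $q_j(\mathbf{r}')\to^*q_j(\mathbf{y}_j^{\mathbf{n}})$ inside $G_j$ with $\mathbf{r}'(i)\ge\mathbf{y}_j^{\mathbf{n}}(i)+1$ for all $i\in\iota(q_j)$. It is *orthogonally simplified* with respect to $\mathbf{n}$ if, for every $i$ that is orthogonal to $G_j$ and bounded at $p_j$, every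 path of $G_j$ from $p_j$, started at $\mathbf{x}_j^{\mathbf{n}}$, ends at a location with nonnegative $i$-th entry. The instance $\mathbf{a}\Xi\mathbf{b}$ is *normal* if $\mathcal{E}$ has a solution and there is some $\mathbf{n}\in\mathcal{H}(\mathcal{E})$ such that every component $\Xi_j$ is either linear, or unbounded, $\mathbf{n}$-pumpable and orthogonally simplified with respect to $\mathbf{n}$. **Proposition.** For every dimension $D$ there is a polynomial $P$ such that every normal instance $\mathbf{a}\Xi\mathbf{b}$ of dimension $D$ has a witness of length at most $2^{P(|\mathbf{a}\Xi\mathbf{b}|)}$. -/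

import Mathlib

/-- A `D`-dimensional vector addition system with states: a finite directed multigraph (self loops
and parallel edges are admitted) whose edges are labelled by displacements in `ℤ^D`. -/
structure VASS (D : ℕ) where
  numStates : ℕ
  numTrans : ℕ
  src : Fin numTrans → Fin numStates
  tgt : Fin numTrans → Fin numStates
  label : Fin numTrans → Fin D → ℤ

namespace VASS

variable {D : ℕ}

/-- States. -/
abbrev State (G : VASS D) : Type := Fin G.numStates

/-- Transitions (edges). -/
abbrev Trans (G : VASS D) : Type := Fin G.numTrans

/-- `G.IsPath p π q`: the edge sequence `π` is a path in `G` from `p` to `q`. -/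
def IsPath (G : VASS D) (p : G.State) : List G.Trans → G.State → Prop
  | [], q => p = q
  | e :: π, q => G.src e = p ∧ IsPath G (G.tgt e) π q

/-- The displacement of a path, the sum of its labels. -/
def disp (G : VASS D) (π : List G.Trans) : Fin D → ℤ :=
  (π.map G.label).sum

/-- The displacement of a Parikh image. -/
def dispParikh (G : VASS D) (ψ : G.Trans → ℕ) : Fin D → ℤ :=
  ∑ e, (ψ e : ℤ) • G.label e

/-- The edge sequence `π`, started at location `r`, visits only locations whose entries
with index in `I` are nonnegative. -/
def StaysNonneg (G : VASS D) (I : Set (Fin D)) (r : Fin D → ℤ) (π : List G.Trans) : Prop :=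
  ∀ n ≤ π.length, ∀ i ∈ I, 0 ≤ (r + G.disp (π.take n)) i

/-- `G.IsIWalk I p r π q s`: `π` is an `I`-walk from `p(r)` to `q(s)`. -/
def IsIWalk (G : VASS D) (I : Set (Fin D)) (p : G.State) (r : Fin D → ℤ)
    (π : List G.Trans) (q : G.State) (s : Fin D → ℤ) : Prop :=
  G.IsPath p π q ∧ s = r + G.disp π ∧ G.StaysNonneg I r π

/-- The natural vector `a` seen as an integer vector. -/
def toInt (a : Fin D → ℕ) : Fin D → ℤ := fun i => (a i : ℤ)

/-- `G.IsWalk p a π q b`: `π` is a walk from the configuration `p(a)` to `q(b)`, that is a path all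
of whose locations are in `ℕ^D`. -/
def IsWalk (G : VASS D) (p : G.State) (a : Fin D → ℕ)
    (π : List G.Trans) (q : G.State) (b : Fin D → ℕ) : Prop :=
  G.IsIWalk Set.univ p (toInt a) π q (toInt b)

/-- Strong connectedness. -/
def StronglyConnected (G : VASS D) : Prop :=
  ∀ p q : G.State, ∃ π, G.IsPath p π q

/-- A circular graph: strongly connected, with at least one edge, and every vertex has exactly one
incoming and exactly one out-going edge. -/
def Circular (G : VASS D) : Prop :=
  G.StronglyConnected ∧ 0 < G.numTrans ∧
    (∀ p : G.State, ∃! e : G.Trans, G.src e = p) ∧ (∀ p : G.State, ∃! e : G.Trans, G.tgt e = p)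

/-- A simple cycle: a nonempty circular path visiting no vertex twice. -/
def IsSimpleCycle (G : VASS D) (π : List G.Trans) : Prop :=
  π ≠ [] ∧ (∃ p, G.IsPath p π p) ∧ (π.map G.src).Nodup

/-- The index `i` is orthogonal to `G`: every simple cycle has displacement `0` in entry `i`. -/
def Orthogonal (G : VASS D) (i : Fin D) : Prop :=
  ∀ π, G.IsSimpleCycle π → G.disp π i = 0

/-- Length of the binary code of a natural number. -/
def natBits (n : ℕ) : ℕ := max 1 n.size

/-- Length of the binary code (with a sign bit) of an integer vector. -/
def vecBits (t : Fin D → ℤ) : ℕ := ∑ i, (1 + natBits (t i).natAbs)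

/-- Length of the binary code of `G`: the list of the states, followed by the list of the
transitions, each given by its source, its target and its label. -/
def size (G : VASS D) : ℕ :=
  G.numStates * natBits G.numStates + ∑ e, (2 * natBits G.numStates + vecBits (G.label e))

end VASS

/-- A constraint graph `pGq`: a strongly connected VASS with an entry and an exit state. -/
structure ConstraintGraph (D : ℕ) extends VASS D where
  entry : Fin numStates
  exit : Fin numStates
  stronglyConnected : toVASS.StronglyConnected

namespace ConstraintGraph

variable {D : ℕ}

/-- Length of the binary code of a constraint graph. -/
def size (X : ConstraintGraph D) : ℕ := X.toVASS.size + 2 * VASS.natBits X.numStates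

/-- A linear constraint graph `qGq`, with `G` circular. -/
def IsLinear (X : ConstraintGraph D) : Prop := X.entry = X.exit ∧ X.toVASS.Circular

/-- A lap of a linear constraint graph: the closed path at the entry state that passes every edge
exactly once. -/
def IsLap (X : ConstraintGraph D) (π : List X.Trans) : Prop :=
  X.IsPath X.entry π X.entry ∧ ∀ e, π.count e = 1

end ConstraintGraph

/-- A constraint graph sequence: components `ξ_0, …, ξ_k` and, for each `j < k`, a connecting edge
labelled `conn j` from the exit state of `ξ_j` to the entry state of `ξ_{j+1}`. -/
structure CGS (D : ℕ) where
  k : ℕ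
  comp : Fin (k + 1) → ConstraintGraph D
  conn : Fin k → Fin D → ℤ

namespace CGS

variable {D : ℕ}

/-- The size of a constraint graph sequence, in binary. -/
def size (ξ : CGS D) : ℕ :=
  ∑ j, (ξ.comp j).size + ∑ j, VASS.vecBits (ξ.conn j)

/-- The size `|a| + |ξ| + |b|` of the reachability instance `aξb`, in binary. -/
def instSize (ξ : CGS D) (a b : Fin D → ℕ) : ℕ :=
  ∑ i, VASS.natBits (a i) + ξ.size + ∑ i, VASS.natBits (b i)

/-- A witness to `aξb`: in every component a walk from `p_j(a_j)` to `q_j(b_j)`, where `a_0 = a`,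
`b_k = b`, and the connecting edges lead from `b_j` to `a_{j+1}`. -/
structure Witness (ξ : CGS D) (a b : Fin D → ℕ) where
  entryLoc : Fin (ξ.k + 1) → Fin D → ℕ
  exitLoc : Fin (ξ.k + 1) → Fin D → ℕ
  path : ∀ j, List (ξ.comp j).Trans
  isWalk : ∀ j, (ξ.comp j).IsWalk (ξ.comp j).entry (entryLoc j) (path j) (ξ.comp j).exit (exitLoc j)
  start : entryLoc 0 = a
  conn : ∀ j : Fin ξ.k,
    VASS.toInt (exitLoc j.castSucc) + ξ.conn j = VASS.toInt (entryLoc j.succ)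
  finish : exitLoc (Fin.last ξ.k) = b

/-- The length of a witness, the number of its edges, the `k` connecting edges included. -/
def Witness.length {ξ : CGS D} {a b : Fin D → ℕ} (w : ξ.Witness a b) : ℕ :=
  ∑ j, (w.path j).length + ξ.k

/-- Assignments of natural numbers to the variables of the characteristic system: the entry
locations `x_j`, the exit locations `y_j`, and the edge multiplicities `Ψ_j`. -/
abbrev Assignment (ξ : CGS D) : Type :=
  (Fin (ξ.k + 1) → Fin D → ℕ) × (Fin (ξ.k + 1) → Fin D → ℕ) × (∀ j, (ξ.comp j).Trans → ℕ)

/-- The value of `x_j`. -/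
abbrev Assignment.x {ξ : CGS D} (m : ξ.Assignment) (j : Fin (ξ.k + 1)) : Fin D → ℕ := m.1 j

/-- The value of `y_j`. -/
abbrev Assignment.y {ξ : CGS D} (m : ξ.Assignment) (j : Fin (ξ.k + 1)) : Fin D → ℕ := m.2.1 j

/-- The value of `Ψ_j`. -/
abbrev Assignment.psi {ξ : CGS D} (m : ξ.Assignment) (j : Fin (ξ.k + 1)) :
    (ξ.comp j).Trans → ℕ := m.2.2 j

/-- The solutions of the characteristic system of `aξb`. A linear component contributes in addition
its witness system: its first and its last lap stay in the first orthant, where the number of laps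
is the common value of the `Ψ_j(e)`. -/
structure IsSolution (ξ : CGS D) (a b : Fin D → ℕ) (m : ξ.Assignment) : Prop where
  euler : ∀ j, ∑ e, (m.psi j e : ℤ) •
      ((Pi.single ((ξ.comp j).tgt e) 1 : (ξ.comp j).State → ℤ) - Pi.single ((ξ.comp j).src e) 1) =
    Pi.single (ξ.comp j).exit 1 - Pi.single (ξ.comp j).entry 1
  pos : ∀ j e, 0 < m.psi j e
  disp : ∀ j, VASS.toInt (m.x j) + (ξ.comp j).dispParikh (m.psi j) = VASS.toInt (m.y j)
  conn : ∀ j : Fin ξ.k, VASS.toInt (m.y j.castSucc) + ξ.conn j = VASS.toInt (m.x j.succ)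
  start : m.x 0 = a
  finish : m.y (Fin.last ξ.k) = b
  firstLap : ∀ j, (ξ.comp j).IsLinear → ∀ π, (ξ.comp j).IsLap π →
    (ξ.comp j).StaysNonneg Set.univ (VASS.toInt (m.x j)) π
  lastLap : ∀ j, (ξ.comp j).IsLinear → ∀ π, (ξ.comp j).IsLap π → ∀ e,
    (ξ.comp j).StaysNonneg Set.univ
      (VASS.toInt (m.x j) + ((m.psi j e : ℤ) - 1) • (ξ.comp j).disp π) π

/-- The solutions of the homogeneous characteristic system; they are nontrivial by definition.
(The homogeneous form of the witness system of a linear component reads `x_j ≥ 0` and `y_j ≥ 0`,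
which holds for every assignment.) -/
structure IsHomSolution (ξ : CGS D) (m : ξ.Assignment) : Prop where
  ne_zero : m ≠ 0
  euler : ∀ j, ∑ e, (m.psi j e : ℤ) •
      ((Pi.single ((ξ.comp j).tgt e) 1 : (ξ.comp j).State → ℤ) - Pi.single ((ξ.comp j).src e) 1) = 0
  disp : ∀ j, VASS.toInt (m.x j) + (ξ.comp j).dispParikh (m.psi j) = VASS.toInt (m.y j)
  conn : ∀ j : Fin ξ.k, m.y j.castSucc = m.x j.succ
  start : m.x 0 = 0
  finish : m.y (Fin.last ξ.k) = 0

/-- `aξb` is satisfiable. -/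
def Satisfiable (ξ : CGS D) (a b : Fin D → ℕ) : Prop := ∃ m, ξ.IsSolution a b m

/-- The set of the minimal solutions of the characteristic system (pointwise order). -/
def minSolutions (ξ : CGS D) (a b : Fin D → ℕ) : Set ξ.Assignment :=
  {m | Minimal (ξ.IsSolution a b) m}

/-- The set of the minimal solutions of the homogeneous characteristic system. -/
def homBase (ξ : CGS D) : Set ξ.Assignment := {m | Minimal ξ.IsHomSolution m}

theorem homBase_finite (ξ : CGS D) : ξ.homBase.Finite := by
  have h : IsAntichain (· ≤ ·) ξ.homBase := by
    intro u hu v hv huv hle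
    exact huv (le_antisymm hle (hv.2 hu.1 hle))
  exact h.finite_of_partiallyWellOrderedOn (Set.isPWO_of_wellQuasiOrderedLE ξ.homBase)

/-- The sum of all the minimal solutions of the homogeneous characteristic system. -/
noncomputable def homSum (ξ : CGS D) : ξ.Assignment := ∑ o ∈ ξ.homBase_finite.toFinset, o

/-- The entry `i` is bounded at the entry state `p_j`. -/
def BoundedAtEntry (ξ : CGS D) (j : Fin (ξ.k + 1)) (i : Fin D) : Prop := ¬ 0 < ξ.homSum.x j i

/-- The entry `i` is bounded at the exit state `q_j`. -/
def BoundedAtExit (ξ : CGS D) (j : Fin (ξ.k + 1)) (i : Fin D) : Prop := ¬ 0 < ξ.homSum.y j i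

/-- The component `ξ_j` is unbounded: all its edges are unbounded. -/
def CompUnbounded (ξ : CGS D) (j : Fin (ξ.k + 1)) : Prop := ∀ e, 0 < ξ.homSum.psi j e

/-- The indices that are bounded at `p_j` but not orthogonal to `G_j`. -/
def entryIdx (ξ : CGS D) (j : Fin (ξ.k + 1)) : Set (Fin D) :=
  {i | ξ.BoundedAtEntry j i ∧ ¬ (ξ.comp j).Orthogonal i}

/-- The indices that are bounded at `q_j` but not orthogonal to `G_j`. -/
def exitIdx (ξ : CGS D) (j : Fin (ξ.k + 1)) : Set (Fin D) :=
  {i | ξ.BoundedAtExit j i ∧ ¬ (ξ.comp j).Orthogonal i}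

/-- The component `ξ_j` is forward `m`-pumpable. -/
def ForwardPumpable (ξ : CGS D) (m : ξ.Assignment) (j : Fin (ξ.k + 1)) : Prop :=
  ∃ π r, (ξ.comp j).IsIWalk (ξ.entryIdx j)
      (ξ.comp j).entry (VASS.toInt (m.x j)) π (ξ.comp j).entry r ∧
    ∀ i ∈ ξ.entryIdx j, VASS.toInt (m.x j) i + 1 ≤ r i

/-- The component `ξ_j` is backward `m`-pumpable. -/
def BackwardPumpable (ξ : CGS D) (m : ξ.Assignment) (j : Fin (ξ.k + 1)) : Prop :=
  ∃ π r, (ξ.comp j).IsIWalk (ξ.exitIdx j)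
      (ξ.comp j).exit r π (ξ.comp j).exit (VASS.toInt (m.y j)) ∧
    ∀ i ∈ ξ.exitIdx j, VASS.toInt (m.y j) i + 1 ≤ r i

/-- The component `ξ_j` is `m`-pumpable. -/
def Pumpable (ξ : CGS D) (m : ξ.Assignment) (j : Fin (ξ.k + 1)) : Prop :=
  ξ.ForwardPumpable m j ∧ ξ.BackwardPumpable m j

/-- The component `ξ_j` is orthogonally simplified with respect to `m`: if the index `i` is
orthogonal to `G_j` and bounded at `p_j`, then no state of `G_j` is attached with a negative `i`-th
entry, that is, every path `p_j(x_j^m) ⟶* o(r)` in `ℤ^D` has `r i ≥ 0`. -/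
def OrthogonallySimplified (ξ : CGS D) (m : ξ.Assignment) (j : Fin (ξ.k + 1)) : Prop :=
  ∀ i, (ξ.comp j).Orthogonal i → ξ.BoundedAtEntry j i →
    ∀ (o : (ξ.comp j).State) (π : List (ξ.comp j).Trans),
      (ξ.comp j).IsPath (ξ.comp j).entry π o → 0 ≤ (VASS.toInt (m.x j) + (ξ.comp j).disp π) i

/-- The instance `aξb` is normal. -/
def Normal (ξ : CGS D) (a b : Fin D → ℕ) : Prop :=
  ξ.Satisfiable a b ∧ ∃ n ∈ ξ.minSolutions a b, ∀ j,
    (ξ.comp j).IsLinear ∨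
      (ξ.CompUnbounded j ∧ ξ.Pumpable n j ∧ ξ.OrthogonallySimplified n j)

end CGS

/-! ### Paths, Parikh images and the entries met along a path -/

namespace VASS

variable {D : ℕ} {G : VASS D}

/-! Take the minimal solution $\mathbf n$ provided by normality and the sum $\mathbf O$ of the
minimal homogeneous solutions. Every $\mathbf n+N\mathbf O$ satisfies the equations of $\mathcal E$,
and since the homogeneous equations glue $\mathbf y_{j-1}$ to $\mathbf x_j$ and vanish at both ends,
the components can be treated separately: each needs a walk with Parikh image $\Psi^{\mathbf
n}+N\Psi^{\mathbf O}$ started at $\mathbf x^{\mathbf n}+N\mathbf x^{\mathbf O}$, with one and the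
same $N$ for all components.

A linear component repeats its lap. Entries change by a constant amount from lap to lap, so only the
first and the last lap matter, and these are controlled by the inequalities in $\mathcal E$.

In an unbounded component let $u$ and $v$ be short pumping cycles at entry and exit. For large $R$
the vector $R\Psi^{\mathbf O}-|u|-|v|$, where $|\cdot|$ is the Parikh image, is a positive
circulation, hence by Euler's theorem the Parikh image of a cycle $w$. With $\pi$ an Eulerian path
for $\Psi^{\mathbf n}$, the path $u^c w^c \pi v^c$ has the right Parikh image for $N=cR$. An entry
unbounded at $p_j$ starts high; a bounded one that is not orthogonal is raised by $u$. In either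
case it is at least $c$ after $u^c$, and symmetrically before $v^c$, which suffices for $w$ and
$\pi$ once $c$ is large. Orthogonal bounded entries are covered by orthogonal simplification
(`StronglyConnected.exists_pumped_walk`).

It remains to bound all quantities by $2^{S^{O(1)}}$ with $S=|\mathbf a\Xi\mathbf b|$ and an
exponent depending only on $D$. Minimal solutions are bounded by Siegel's lemma together with a
decomposition along supports (`minimal_homogeneous_le`, `minimal_inhomogeneous_le`). The pumping
cycles are bounded by Rackoff's argument (`Covers.exists_short`); this is where the dimension enters
the exponent. -/

theorem isPath_append {p q : G.State} {π σ : List G.Trans} :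
    G.IsPath p (π ++ σ) q ↔ ∃ s, G.IsPath p π s ∧ G.IsPath s σ q := by
  induction π generalizing p with
  | nil => simp [IsPath]
  | cons e π ih => simp [IsPath, ih, and_assoc]

theorem IsPath.append {p s q : G.State} {π σ : List G.Trans} (h : G.IsPath p π s)
    (h' : G.IsPath s σ q) : G.IsPath p (π ++ σ) q := isPath_append.2 ⟨s, h, h'⟩

@[simp] theorem disp_nil : G.disp [] = 0 := by simp [disp]

@[simp] theorem disp_cons (e : G.Trans) (π : List G.Trans) :
    G.disp (e :: π) = G.label e + G.disp π := by simp [disp]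

@[simp] theorem disp_append (π σ : List G.Trans) :
    G.disp (π ++ σ) = G.disp π + G.disp σ := by simp [disp]

/-- The Parikh image of a path. -/
def parikh (π : List G.Trans) (e : G.Trans) : ℕ := π.count e

@[simp] theorem parikh_nil : parikh (G := G) [] = 0 := by ext; simp [parikh]

theorem parikh_cons (e : G.Trans) (π : List G.Trans) :
    parikh (e :: π) = parikh π + Pi.single e 1 := by
  ext f
  rcases eq_or_ne e f with rfl | h
  · simp [parikh]
  · simp [parikh, List.count_cons_of_ne h, Pi.single_eq_of_ne h.symm]

@[simp] theorem parikh_append (π σ : List G.Trans) :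
    parikh (π ++ σ) = parikh π + parikh σ := by ext; simp [parikh]

theorem length_eq_sum_parikh (π : List G.Trans) : π.length = ∑ e, parikh π e := by
  induction π with
  | nil => simp
  | cons e π ih => simp [parikh_cons, Finset.sum_add_distrib, ih]

theorem dispParikh_add (φ ψ : G.Trans → ℕ) :
    G.dispParikh (φ + ψ) = G.dispParikh φ + G.dispParikh ψ := by
  simp [dispParikh, add_smul, Finset.sum_add_distrib]

theorem dispParikh_smul (c : ℕ) (ψ : G.Trans → ℕ) :
    G.dispParikh (c • ψ) = (c : ℤ) • G.dispParikh ψ := by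
  simp [dispParikh, mul_smul, Finset.smul_sum]

theorem dispParikh_parikh (π : List G.Trans) : G.dispParikh (parikh π) = G.disp π := by
  induction π with
  | nil => simp [dispParikh]
  | cons e π ih =>
    rw [parikh_cons, dispParikh_add, ih, disp_cons, add_comm]
    congr 1
    simp only [dispParikh]
    rw [Finset.sum_eq_single e] <;> simp +contextual

/-- The boundary of a Parikh image. -/
def bdry (G : VASS D) (ψ : G.Trans → ℕ) : G.State → ℤ :=
  ∑ e, (ψ e : ℤ) • ((Pi.single (G.tgt e) 1 : G.State → ℤ) - Pi.single (G.src e) 1)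

theorem bdry_add (φ ψ : G.Trans → ℕ) : G.bdry (φ + ψ) = G.bdry φ + G.bdry ψ := by
  simp only [bdry, Pi.add_apply, Nat.cast_add, add_smul, Finset.sum_add_distrib]

theorem bdry_smul (c : ℕ) (ψ : G.Trans → ℕ) : G.bdry (c • ψ) = (c : ℤ) • G.bdry ψ := by
  simp only [bdry, Pi.smul_apply, smul_eq_mul, Nat.cast_mul, mul_smul, Finset.smul_sum]

theorem IsPath.bdry_parikh {p q : G.State} {π : List G.Trans} (h : G.IsPath p π q) :
    G.bdry (parikh π) = Pi.single q 1 - Pi.single p 1 := by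
  induction π generalizing p with
  | nil => obtain rfl : p = q := h; simp [bdry]
  | cons e π ih =>
    rw [parikh_cons, bdry_add, ih h.2, ← h.1]
    have : G.bdry (Pi.single e 1) = Pi.single (G.tgt e) 1 - Pi.single (G.src e) 1 := by
      simp only [bdry]
      rw [Finset.sum_eq_single e] <;> simp +contextual
    rw [this]; abel

theorem bdry_apply (ψ : G.Trans → ℕ) (s : G.State) :
    G.bdry ψ s = (∑ e with G.tgt e = s, (ψ e : ℤ)) - ∑ e with G.src e = s, (ψ e : ℤ) := by
  simp only [bdry, Finset.sum_apply, Pi.smul_apply, Pi.sub_apply, Pi.single_apply, smul_eq_mul,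
    mul_sub, Finset.sum_sub_distrib, mul_ite, mul_one, mul_zero, Finset.sum_filter, eq_comm (a := s)]

theorem abs_disp_le {A : ℕ} (hA : ∀ e i, |G.label e i| ≤ A) (π : List G.Trans) (i : Fin D) :
    |G.disp π i| ≤ A * π.length := by
  induction π with
  | nil => simp
  | cons e π ih =>
    have := abs_add_le (G.label e i) (G.disp π i)
    have := hA e i
    simp only [disp_cons, Pi.add_apply, List.length_cons, Nat.cast_add, Nat.cast_one]
    linarith

theorem staysNonneg_iff {I : Set (Fin D)} {r : Fin D → ℤ} {π : List G.Trans} :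
    G.StaysNonneg I r π ↔ ∀ σ τ, π = σ ++ τ → ∀ i ∈ I, 0 ≤ (r + G.disp σ) i := by
  constructor
  · rintro h σ τ rfl i hi
    simpa using h σ.length (by simp) i hi
  · intro h n _ i hi
    exact h (π.take n) (π.drop n) (by simp) i hi

theorem StaysNonneg.start {I : Set (Fin D)} {r : Fin D → ℤ} {π : List G.Trans}
    (h : G.StaysNonneg I r π) {i : Fin D} (hi : i ∈ I) : 0 ≤ r i := by
  simpa using h 0 (by simp) i hi

theorem staysNonneg_append {I : Set (Fin D)} {r : Fin D → ℤ} {π σ : List G.Trans} :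
    G.StaysNonneg I r (π ++ σ) ↔ G.StaysNonneg I r π ∧ G.StaysNonneg I (r + G.disp π) σ := by
  simp only [staysNonneg_iff]
  constructor
  · refine fun h => ⟨fun α β hα i hi => h α (β ++ σ) (by simp [hα]) i hi, fun α β hα i hi => ?_⟩
    have := h (π ++ α) β (by simp [hα]) i hi
    simpa [add_assoc] using this
  · rintro ⟨h₁, h₂⟩ α β hα i hi
    rcases List.append_eq_append_iff.1 hα with ⟨γ, rfl, hγ⟩ | ⟨γ, rfl, hγ⟩
    · have := h₂ γ β hγ i hi
      simpa [add_assoc] using this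
    · exact h₁ α γ rfl i hi

theorem StaysNonneg.mono {I J : Set (Fin D)} {r : Fin D → ℤ} {π : List G.Trans}
    (h : G.StaysNonneg I r π) (hJ : J ⊆ I) : G.StaysNonneg J r π :=
  fun n hn i hi => h n hn i (hJ hi)

theorem staysNonneg_of_le {I : Set (Fin D)} {r s : Fin D → ℤ} {π : List G.Trans}
    (h : G.StaysNonneg I r π) (hs : ∀ i ∈ I, r i ≤ s i) : G.StaysNonneg I s π := fun n hn i hi => by
  have h₁ := h n hn i hi
  have h₂ := hs i hi
  simp only [Pi.add_apply] at *
  linarith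

/-- A path of length $\ell$ lowers no entry by more than $A\ell$. -/
theorem staysNonneg_of_large {A : ℕ} (hA : ∀ e i, |G.label e i| ≤ A) {I : Set (Fin D)}
    {r : Fin D → ℤ} {π : List G.Trans} (h : ∀ i ∈ I, (A * π.length : ℤ) ≤ r i) :
    G.StaysNonneg I r π := by
  rw [staysNonneg_iff]
  rintro σ τ rfl i hi
  have h₁ := h i hi
  have h₂ := (abs_le.1 (abs_disp_le hA σ i)).1
  have h₃ : (0 : ℤ) ≤ A * τ.length := by positivity
  simp only [Pi.add_apply, List.length_append, Nat.cast_add, mul_add] at *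
  linarith

/-- Large end locations. -/
theorem staysNonneg_of_large_end {A : ℕ} (hA : ∀ e i, |G.label e i| ≤ A) {I : Set (Fin D)}
    {r : Fin D → ℤ} {π : List G.Trans} (h : ∀ i ∈ I, (A * π.length : ℤ) ≤ (r + G.disp π) i) :
    G.StaysNonneg I r π := by
  rw [staysNonneg_iff]
  rintro σ τ rfl i hi
  have h₁ := h i hi
  have h₂ := (abs_le.1 (abs_disp_le hA τ i)).2
  have h₃ : (0 : ℤ) ≤ A * σ.length := by positivity
  simp only [disp_append, Pi.add_apply, List.length_append, Nat.cast_add, mul_add] at *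
  linarith

theorem staysNonneg_univ_iff {r : Fin D → ℤ} {π : List G.Trans} :
    G.StaysNonneg Set.univ r π ↔ ∀ i, G.StaysNonneg {i} r π := by
  simp only [StaysNonneg, Set.mem_univ, true_imp_iff, Set.mem_singleton_iff, forall_eq]
  exact ⟨fun h i n hn => h n hn i, fun h n hn i => h i n hn⟩

/-- The `c`-fold repetition of a path. -/
def power (π : List G.Trans) (c : ℕ) : List G.Trans := (List.replicate c π).flatten

@[simp] theorem power_zero (π : List G.Trans) : power π 0 = [] := rfl

theorem power_succ (π : List G.Trans) (c : ℕ) : power π (c + 1) = π ++ power π c := by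
  simp [power, List.replicate_succ]

theorem IsPath.power {p : G.State} {π : List G.Trans} (h : G.IsPath p π p) (c : ℕ) :
    G.IsPath p (power π c) p := by
  induction c with
  | zero => rfl
  | succ c ih => rw [power_succ]; exact h.append ih

theorem disp_power (π : List G.Trans) (c : ℕ) : G.disp (power π c) = (c : ℤ) • G.disp π := by
  induction c with
  | zero => simp
  | succ c ih => rw [power_succ, disp_append, ih]; push_cast; rw [add_smul, one_smul, add_comm]

theorem staysNonneg_power_of_forall {I : Set (Fin D)} {r : Fin D → ℤ} {π : List G.Trans} {c : ℕ}
    (h₀ : ∀ i ∈ I, 0 ≤ r i) (h : ∀ s < c, G.StaysNonneg I (r + (s : ℤ) • G.disp π) π) :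
    G.StaysNonneg I r (power π c) := by
  induction c generalizing r with
  | zero => intro n _ i hi; simpa using h₀ i hi
  | succ c ih =>
    rw [power_succ, staysNonneg_append]
    have h₁ : G.StaysNonneg I r π := by simpa using h 0 (by simp)
    refine ⟨h₁, ih (fun i hi => ?_) fun s hs => ?_⟩
    · simpa using h₁ π.length le_rfl i hi
    · have := h (s + 1) (by omega)
      convert this using 1
      push_cast
      rw [add_smul, one_smul]; abel

/-- If the first and the last repetition stay nonnegative, then so do all. -/
theorem staysNonneg_power {I : Set (Fin D)} {r : Fin D → ℤ} {π : List G.Trans} {c : ℕ}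
    (h₁ : G.StaysNonneg I r π) (h₂ : G.StaysNonneg I (r + ((c : ℤ) - 1) • G.disp π) π) :
    G.StaysNonneg I r (power π c) := by
  refine staysNonneg_power_of_forall (fun i hi => h₁.start hi) fun s hs n hn i hi => ?_
  have h₁ := h₁ n hn i hi
  have h₂ := h₂ n hn i hi
  simp only [Pi.add_apply, Pi.smul_apply, smul_eq_mul] at *
  have hs' : (s : ℤ) + 1 ≤ c := by exact_mod_cast hs
  -- Each intermediate entry is affine in the repetition number $s$, so over $0\le s\le c-1$ it is
  -- smallest at an end: at the first repetition if the displacement is nonnegative, at the last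
  -- otherwise.
  rcases le_total 0 (G.disp π i) with hd | hd
  · have : 0 ≤ (s : ℤ) * G.disp π i := by positivity
    linarith
  · have : ((c : ℤ) - 1) * G.disp π i ≤ s * G.disp π i :=
      mul_le_mul_of_nonpos_right (by linarith) hd
    linarith

/-- The reversed graph, with negated labels. -/
abbrev rev (G : VASS D) : VASS D where
  numStates := G.numStates
  numTrans := G.numTrans
  src := G.tgt
  tgt := G.src
  label := fun e => - G.label e

theorem isPath_rev {p q : G.State} {π : List G.Trans} :
    G.rev.IsPath q π.reverse p ↔ G.IsPath p π q := by
  induction π generalizing p with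
  | nil => exact eq_comm
  | cons e π ih =>
    rw [List.reverse_cons]
    refine (isPath_append (G := G.rev)).trans ?_
    simp only [IsPath]
    constructor
    · rintro ⟨s, hs, hs', hs''⟩
      refine ⟨hs'', ih.1 ?_⟩
      have : s = G.tgt e := hs'.symm
      rwa [this] at hs
    · rintro ⟨h, h'⟩
      exact ⟨G.tgt e, ih.2 h', rfl, h⟩

theorem disp_rev (π : List G.Trans) : G.rev.disp π.reverse = - G.disp π := by
  induction π with
  | nil => simp [disp]
  | cons e π ih =>
    rw [List.reverse_cons, disp_append (G := G.rev), ih, disp_cons (G := G.rev),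
      disp_nil (G := G.rev), disp_cons, neg_add, add_comm, add_zero]

/-- Backward pumping becomes forward pumping in the reversed graph: the reversed path, started where
the path ends, visits the same locations. -/
theorem StaysNonneg.rev {I : Set (Fin D)} {r : Fin D → ℤ} {π : List G.Trans}
    (h : G.StaysNonneg I r π) : G.rev.StaysNonneg I (r + G.disp π) π.reverse := by
  rw [staysNonneg_iff] at h
  refine staysNonneg_iff.2 fun (σ τ : List G.Trans) hσ i hi => ?_
  have hπ : π = τ.reverse ++ σ.reverse := by
    rw [← List.reverse_append, ← hσ, List.reverse_reverse]
  have h' := h _ _ hπ i hi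
  have hd : G.rev.disp σ = - G.disp σ.reverse := by
    conv_lhs => rw [← List.reverse_reverse σ]
    exact disp_rev _
  rw [hd, hπ, disp_append]
  simp only [Pi.add_apply, Pi.neg_apply] at *
  linarith

end VASS

/-! ### Eulerian paths and closed paths -/

namespace VASS

variable {D : ℕ} {G : VASS D}

/-- A trail of maximal length ends at the exit, and exhausts the edges there. -/
theorem exists_exhausting_trail {ψ : G.Trans → ℕ} {p q : G.State}
    (hψ : G.bdry ψ = Pi.single q 1 - Pi.single p 1) :
    ∃ π, G.IsPath p π q ∧ parikh π ≤ ψ ∧ ∀ e, G.src e = q → parikh π e = ψ e := by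
  let P : ℕ → Prop := fun n => ∃ π s, G.IsPath p π s ∧ parikh π ≤ ψ ∧ π.length = n
  have hP : ∃ n, P n ∧ ∀ m, P m → m ≤ n := by
    have hb : ∀ n, P n → n ≤ ∑ e, ψ e := by
      rintro n ⟨π, s, -, h, rfl⟩
      rw [length_eq_sum_parikh]
      exact Finset.sum_le_sum fun e _ => h e
    classical
    have h0 : P 0 := ⟨[], p, rfl, by simp, rfl⟩
    exact ⟨Nat.findGreatest P (∑ e, ψ e), Nat.findGreatest_spec (Nat.zero_le _) h0,
      fun m hm => Nat.le_findGreatest (hb m hm) hm⟩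
  obtain ⟨n, ⟨π, s, hπ, hle, rfl⟩, hmax⟩ := hP
  -- An unexhausted edge at the end state would prolong the trail.
  have hex : ∀ e, G.src e = s → parikh π e = ψ e := by
    intro e he
    by_contra hne
    have hlt : parikh π e < ψ e := lt_of_le_of_ne (hle e) hne
    have := hmax (π ++ [e]).length ⟨π ++ [e], G.tgt e, hπ.append ⟨he, rfl⟩, fun f => ?_, rfl⟩
    · simp at this
    · rw [parikh_append, parikh_cons, parikh_nil]
      rcases eq_or_ne f e with rfl | hf
      · simpa using hlt
      · simpa [hf] using hle f
  -- If $s\ne q$, the boundary of the trail at $s$ exceeds that of `ψ` by one. But the outflows at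
  -- $s$ agree and the inflow of the trail is at most that of `ψ`.
  have hs : s = q := by
    by_contra hne
    have h₁ := congrFun hπ.bdry_parikh s
    have h₂ := congrFun hψ s
    rw [bdry_apply] at h₁ h₂
    have h₃ : ∑ e with G.src e = s, (parikh π e : ℤ) = ∑ e with G.src e = s, (ψ e : ℤ) :=
      Finset.sum_congr rfl fun e he => by rw [hex e (by simpa using he)]
    have h₄ : ∑ e with G.tgt e = s, (parikh π e : ℤ) ≤ ∑ e with G.tgt e = s, (ψ e : ℤ) :=
      Finset.sum_le_sum fun e _ => by exact_mod_cast hle e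
    simp only [Pi.sub_apply, Pi.single_eq_same, Pi.single_eq_of_ne hne] at h₁ h₂
    linarith
  exact ⟨π, hs ▸ hπ, hle, hs ▸ hex⟩

/-- A path leaving a set of states has a first edge that leaves it. -/
theorem IsPath.exists_exit {p q : G.State} {π : List G.Trans} (h : G.IsPath p π q)
    (V : Set G.State) (hp : p ∈ V) (hq : q ∉ V) : ∃ e, G.src e ∈ V ∧ G.tgt e ∉ V := by
  induction π generalizing p with
  | nil => exact absurd ((h : p = q) ▸ hp) hq
  | cons e π ih =>
    by_cases he : G.tgt e ∈ V
    · exact ih h.2 he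
    · exact ⟨e, h.1 ▸ hp, he⟩

/-- Euler's theorem on directed multigraphs. -/
theorem StronglyConnected.exists_eulerian_path (hG : G.StronglyConnected) {ψ : G.Trans → ℕ}
    {p q : G.State} (hpos : ∀ e, 0 < ψ e) (hψ : G.bdry ψ = Pi.single q 1 - Pi.single p 1) :
    ∃ π, G.IsPath p π q ∧ parikh π = ψ := by
  let P : ℕ → Prop := fun n => ∃ π, G.IsPath p π q ∧ parikh π ≤ ψ ∧ π.length = n
  have hP : ∃ n, P n ∧ ∀ m, P m → m ≤ n := by
    have hb : ∀ n, P n → n ≤ ∑ e, ψ e := by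
      rintro n ⟨π, -, h, rfl⟩
      rw [length_eq_sum_parikh]
      exact Finset.sum_le_sum fun e _ => h e
    classical
    obtain ⟨π, h₁, h₂, -⟩ := exists_exhausting_trail hψ
    have h0 : P π.length := ⟨π, h₁, h₂, rfl⟩
    exact ⟨Nat.findGreatest P (∑ e, ψ e), Nat.findGreatest_spec (hb _ h0) h0,
      fun m hm => Nat.le_findGreatest (hb m hm) hm⟩
  obtain ⟨n, ⟨π, hπ, hle, rfl⟩, hmax⟩ := hP
  refine ⟨π, hπ, ?_⟩
  by_contra hne
  obtain ⟨e, he⟩ : ∃ e, parikh π e < ψ e := by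
    by_contra! h
    exact hne (le_antisymm hle h)
  -- Some state visited by the longest path still has an unexhausted outgoing edge. If the source of
  -- `e` is not visited, strong connectedness gives an edge leaving the visited set; the path never
  -- uses it, and its multiplicity is positive.
  obtain ⟨s, ⟨α, β, hαβ, hα, hβ⟩, f, hf, hlt⟩ :
      ∃ s, (∃ α β, π = α ++ β ∧ G.IsPath p α s ∧ G.IsPath s β q) ∧
        ∃ f, G.src f = s ∧ parikh π f < ψ f := by
    let V : Set G.State := {s | ∃ α β, π = α ++ β ∧ G.IsPath p α s ∧ G.IsPath s β q}
    by_cases hV : G.src e ∈ V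
    · exact ⟨G.src e, hV, e, rfl, he⟩
    obtain ⟨ρ, hρ⟩ := hG p (G.src e)
    obtain ⟨f, hf, hf'⟩ := hρ.exists_exit V ⟨[], π, rfl, rfl, hπ⟩ hV
    refine ⟨_, hf, f, rfl, ?_⟩
    have : f ∉ π := by
      intro hmem
      obtain ⟨α, β, rfl⟩ := List.append_of_mem hmem
      obtain ⟨s, hs, hs'⟩ := isPath_append.1 hπ
      exact hf' ⟨α ++ [f], β, by simp, hs.append ⟨hs'.1, rfl⟩, hs'.2⟩
    rw [parikh, List.count_eq_zero_of_not_mem this]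
    exact hpos f
  -- The residual is balanced, so an exhausting trail from $s$ in it closes up at $s$. It uses `f`,
  -- hence is nonempty, and inserting it contradicts maximality.
  have hres : G.bdry (ψ - parikh π) = Pi.single s 1 - Pi.single s 1 := by
    have : G.bdry (ψ - parikh π + parikh π) = G.bdry ψ := by rw [tsub_add_cancel_of_le hle]
    rw [bdry_add, hψ, hπ.bdry_parikh] at this
    rw [sub_self]
    simpa using this
  obtain ⟨γ, hγ, hγle, hγex⟩ := exists_exhausting_trail hres
  have hlen := hmax (α ++ γ ++ β).length ⟨α ++ γ ++ β, (hα.append hγ).append hβ, fun e => ?_, rfl⟩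
  · have hγ0 : γ = [] := by
      rw [← List.length_eq_zero_iff]
      simp only [hαβ, List.length_append] at hlen
      omega
    have := hγex f hf
    simp only [hγ0, parikh_nil, Pi.zero_apply, Pi.sub_apply] at this
    omega
  · have h₁ := hγle e
    have h₂ := hle e
    simp only [hαβ, parikh_append, Pi.add_apply, Pi.sub_apply] at *
    omega

/-- In an orthogonal entry every closed path has displacement `0`. -/
theorem Orthogonal.disp_eq_zero {i : Fin D} (hi : G.Orthogonal i) {p : G.State}
    {π : List G.Trans} (hπ : G.IsPath p π p) : G.disp π i = 0 := by
  induction hn : π.length using Nat.strong_induction_on generalizing p π with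
  | _ n ih =>
  subst hn
  rcases eq_or_ne π [] with rfl | hne
  · simp
  by_cases hnd : (π.map G.src).Nodup
  · exact hi π ⟨hne, ⟨p, hπ⟩, hnd⟩
  -- A repeated source state splits the closed path into the closed path `e :: β` and the closed
  -- remainder `α ++ f :: γ`, both shorter.
  obtain ⟨α, e, β, f, γ, rfl, hef⟩ :
      ∃ α e β f γ, π = α ++ e :: (β ++ f :: γ) ∧ G.src e = G.src f := by
    clear ih hne hπ
    induction π with
    | nil => simp at hnd
    | cons e π ih =>
      by_cases h : G.src e ∈ π.map G.src
      · obtain ⟨f, hf, hfe⟩ := List.mem_map.1 h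
        obtain ⟨β, γ, rfl⟩ := List.append_of_mem hf
        exact ⟨[], e, β, f, γ, rfl, hfe.symm⟩
      · obtain ⟨α, e', β, f, γ, rfl, h'⟩ := ih (by simpa [List.map_cons, List.nodup_cons, h] using hnd)
        exact ⟨e :: α, e', β, f, γ, rfl, h'⟩
  obtain ⟨s, hα, hes, hβ⟩ := isPath_append.1 hπ
  obtain ⟨t, hβ, hft, hγ⟩ := isPath_append.1 hβ
  have h₁ := ih (e :: β).length (by simp; omega) (p := s) (π := e :: β)
    ⟨hes, by rw [← hes, hef, hft]; exact hβ⟩ rfl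
  have h₂ := ih (α ++ f :: γ).length (by simp) (p := p) (π := α ++ f :: γ)
    (hα.append ⟨by rw [← hef, hes], hγ⟩) rfl
  simp only [disp_append, disp_cons, Pi.add_apply] at *
  linarith

end VASS

/-! ### Exponential bounds and Rackoff's theorem -/

namespace VASS

variable {D : ℕ} {G : VASS D}

/-! ### Bounds of the form `2 ^ S ^ a` -/

section ExpBounds

variable {S : ℕ}

theorem exp_mono (hS : 2 ≤ S) {a b x : ℕ} (hx : x ≤ 2 ^ S ^ a) (h : a ≤ b) : x ≤ 2 ^ S ^ b :=
  hx.trans (Nat.pow_le_pow_right (by norm_num) (Nat.pow_le_pow_right (by omega) h))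

/-- In this calculus each product or sum costs one unit of the exponent $a$, because $2S^a\le
S^{a+1}$. A power with exponent at most $S^b$ costs $b$ units. -/
theorem exp_mul (hS : 2 ≤ S) {a x y : ℕ} (hx : x ≤ 2 ^ S ^ a) (hy : y ≤ 2 ^ S ^ a) :
    x * y ≤ 2 ^ S ^ (a + 1) := by
  refine (Nat.mul_le_mul hx hy).trans ?_
  rw [← pow_add, pow_succ]
  exact Nat.pow_le_pow_right (by norm_num) (by nlinarith [Nat.zero_le (S ^ a)])

theorem two_le_exp (hS : 2 ≤ S) (a : ℕ) : 2 ≤ 2 ^ S ^ a :=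
  calc 2 = 2 ^ 1 := rfl
    _ ≤ 2 ^ S ^ a := Nat.pow_le_pow_right (by norm_num) (Nat.one_le_pow _ _ (by omega))

theorem exp_add (hS : 2 ≤ S) {a x y : ℕ} (hx : x ≤ 2 ^ S ^ a) (hy : y ≤ 2 ^ S ^ a) :
    x + y ≤ 2 ^ S ^ (a + 1) := by
  have := exp_mul hS (le_refl (2 ^ S ^ a)) le_rfl
  have := two_le_exp hS a
  nlinarith

theorem exp_pow {a b x n : ℕ} (hx : x ≤ 2 ^ S ^ a) (hn : n ≤ S ^ b) :
    x ^ n ≤ 2 ^ S ^ (a + b) := by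
  refine (Nat.pow_le_pow_left hx n).trans ?_
  rw [← pow_mul, pow_add S]
  exact Nat.pow_le_pow_right (by norm_num) (Nat.mul_le_mul_left _ hn)

theorem le_exp {a x : ℕ} (hx : x ≤ S ^ a) : x ≤ 2 ^ S ^ a :=
  hx.trans Nat.lt_two_pow_self.le

end ExpBounds

/-- `G.Covers J t p r π q`: from `p(r)` the path `π` leads to `q` and to a location above `t` on `J`,
and on the way the entries in `J` stay nonnegative. -/
structure Covers (G : VASS D) (J : Finset (Fin D)) (t : Fin D → ℤ) (p : G.State) (r : Fin D → ℤ)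
    (π : List G.Trans) (q : G.State) : Prop where
  isPath : G.IsPath p π q
  stays : G.StaysNonneg J r π
  le : ∀ i ∈ J, t i ≤ (r + G.disp π) i

/-- Rackoff's bound on the length of covering paths. -/
def rackoff (Q A B : ℕ) : ℕ → ℕ
  | 0 => Q
  | j + 1 => Q * (B + A * rackoff Q A B j) ^ (j + 1) + rackoff Q A B j

/-- In a shortest covering path, the initial part with entries below `C` is short. -/
theorem Covers.card_le {J : Finset (Fin D)} {t r : Fin D → ℤ} {p q : G.State} {π : List G.Trans}
    (h : G.Covers J t p r π q) (hmin : ∀ σ, G.Covers J t p r σ q → π.length ≤ σ.length)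
    {C N : ℕ} (hN : N ≤ π.length + 1)
    (hC : ∀ n < N, ∀ i ∈ J, (r + G.disp (π.take n)) i < C) :
    N ≤ G.numStates * C ^ J.card := by
  have hst : ∀ n, ∃ s, G.IsPath p (π.take n) s ∧ G.IsPath s (π.drop n) q := fun n =>
    isPath_append.1 (by rw [List.take_append_drop]; exact h.isPath)
  choose st hst hst' using hst
  have hcut : ∀ n, G.StaysNonneg J r (π.take n) ∧
      G.StaysNonneg J (r + G.disp (π.take n)) (π.drop n) := fun n => by
    rw [← staysNonneg_append, List.take_append_drop]
    exact h.stays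
  -- Two prefixes ending in the same state with the same entries on `J` would allow the piece
  -- between them to be cut out. Hence prefixes of lengths below `N` inject into states times
  -- $\{0,\dots,C-1\}^J$. There are `π.length + 1` prefixes, whence the bound on `N`.
  have hinj : ∀ a b, a < b → b < N → st a = st b →
      (∀ i ∈ J, (r + G.disp (π.take a)) i = (r + G.disp (π.take b)) i) → False := by
    intro a b hab hb hs hd
    have hdisp : ∀ i ∈ J, (r + G.disp (π.take a ++ π.drop b)) i = (r + G.disp π) i := by
      intro i hi
      have h₁ := hd i hi
      have h₂ : G.disp (π.take b ++ π.drop b) = G.disp π := by rw [List.take_append_drop]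
      rw [← h₂]
      simp only [disp_append, Pi.add_apply] at *
      linarith
    have := hmin (π.take a ++ π.drop b) ⟨(hst a).append (hs ▸ hst' b), staysNonneg_append.2
      ⟨(hcut a).1, staysNonneg_of_le (hcut b).2 fun i hi => (hd i hi).ge⟩,
      fun i hi => (h.le i hi).trans (hdisp i hi).ge⟩
    simp only [List.length_append, List.length_take, List.length_drop] at this
    omega
  have hnn : ∀ n < N, ∀ i ∈ J, 0 ≤ (r + G.disp (π.take n)) i := fun n hn i hi =>
    h.stays n (by omega) i hi
  let f : Fin N → G.State × (J → Fin C) := fun n => (st n, fun i =>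
    ⟨((r + G.disp (π.take n)) i).toNat, by
      have := hC n n.2 i i.2
      have := hnn n n.2 i i.2
      omega⟩)
  have hf : ∀ a b : Fin N, a < b → f a ≠ f b := by
    intro a b hab hfab
    refine hinj a b hab b.2 (congrArg Prod.fst hfab) fun i hi => ?_
    have h₁ := congrArg Fin.val (congrFun (congrArg Prod.snd hfab) ⟨i, hi⟩)
    have h₂ := hnn a a.2 i hi
    have h₃ := hnn b b.2 i hi
    simp only [f] at h₁
    omega
  have hf' : Function.Injective f := by
    intro a b hab
    rcases lt_trichotomy a b with hlt | rfl | hlt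
    · exact absurd hab (hf _ _ hlt)
    · rfl
    · exact absurd hab.symm (hf _ _ hlt)
  simpa using Fintype.card_le_of_injective f hf'

/-- Rackoff's theorem. -/
theorem Covers.exists_short {A B : ℕ} (hA : ∀ e i, |G.label e i| ≤ A) {t : Fin D → ℤ}
    (ht : ∀ i, t i ≤ B) (J : Finset (Fin D)) {r : Fin D → ℤ} {p q : G.State} {π : List G.Trans}
    (h : G.Covers J t p r π q) :
    ∃ σ, G.Covers J t p r σ q ∧ σ.length ≤ rackoff G.numStates A B J.card := by
  induction hj : J.card generalizing J r p π with
  | zero =>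
    obtain ⟨σ, hσ, hmin⟩ := exists_minimalFor_of_wellFoundedLT (fun σ => G.Covers J t p r σ q)
      List.length ⟨π, h⟩
    have hmin' : ∀ τ, G.Covers J t p r τ q → σ.length ≤ τ.length := fun τ hτ =>
      (le_total σ.length τ.length).elim id fun hle => hmin hτ hle
    have := hσ.card_le hmin' (C := 0) le_rfl fun n _ i hi => by
      simp [Finset.card_eq_zero.1 hj] at hi
    refine ⟨σ, hσ, ?_⟩
    simp only [hj, pow_zero, mul_one] at this
    simp only [rackoff]
    omega
  | succ j ih =>
    obtain ⟨σ, hσ, hmin⟩ := exists_minimalFor_of_wellFoundedLT (fun σ => G.Covers J t p r σ q)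
      List.length ⟨π, h⟩
    have hmin' : ∀ τ, G.Covers J t p r τ q → σ.length ≤ τ.length := fun τ hτ =>
      (le_total σ.length τ.length).elim id fun hle => hmin hτ hle
    refine ⟨σ, hσ, ?_⟩
    set L := rackoff G.numStates A B j with hL
    set C := B + A * L with hC
    have hrec : rackoff G.numStates A B (j + 1) = G.numStates * C ^ (j + 1) + L := rfl
    rw [hrec]
    classical
    -- Cut at the first time some entry `i` reaches $C=B+AL$. Up to then the pigeonhole bound
    -- applies. Afterwards `i` may be ignored: the induction hypothesis for `J.erase i` gives a
    -- continuation of length at most $L$, which lowers entry `i` by at most $AL$ and so leaves it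
    -- at least $B$.
    by_cases hex : ∃ n, n ≤ σ.length ∧ ∃ i ∈ J, (C : ℤ) ≤ (r + G.disp (σ.take n)) i
    · obtain ⟨hn, i, hi, hCi⟩ := Nat.find_spec hex
      set n := Nat.find hex
      have hcard := hσ.card_le hmin' (C := C) (N := n) (by omega) fun m hm k hk => by
        have := Nat.find_min hex hm
        push Not at this
        exact this (by omega) k hk
      rw [hj] at hcard
      obtain ⟨s, hs, hs'⟩ := isPath_append.1
        (show G.IsPath p (σ.take n ++ σ.drop n) q by rw [List.take_append_drop]; exact hσ.isPath)
      obtain ⟨hst, hst'⟩ := staysNonneg_append.1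
        (show G.StaysNonneg J r (σ.take n ++ σ.drop n) by
          rw [List.take_append_drop]; exact hσ.stays)
      have hsub : ((J.erase i : Finset (Fin D)) : Set (Fin D)) ⊆ J := by simp
      have hdisp : G.disp σ = G.disp (σ.take n) + G.disp (σ.drop n) := by
        rw [← disp_append, List.take_append_drop]
      obtain ⟨τ, hτ, hlen⟩ := ih (J.erase i) (p := s) (r := r + G.disp (σ.take n)) (π := σ.drop n)
        ⟨hs', hst'.mono hsub, fun k hk => by
          have := hσ.le k (Finset.mem_of_mem_erase hk)
          rwa [hdisp, ← add_assoc] at this⟩ (by rw [Finset.card_erase_of_mem hi, hj]; rfl)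
      have hlen' : (A : ℤ) * τ.length ≤ A * L := by exact_mod_cast Nat.mul_le_mul_left A hlen
      have hcov : G.Covers J t p r (σ.take n ++ τ) q := by
        refine ⟨hs.append hτ.isPath, staysNonneg_append.2 ⟨hst, fun m hm k hk => ?_⟩, fun k hk => ?_⟩
        · by_cases hki : k = i
          · subst hki
            refine staysNonneg_of_large hA (I := {k}) (fun l hl => ?_) m hm k rfl
            rw [Set.mem_singleton_iff.1 hl]
            have : (C : ℤ) = B + A * L := by simp [hC]
            linarith [(Int.natCast_nonneg B)]
          · exact hτ.stays m hm k (by simpa [hki] using hk)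
        · rw [disp_append, ← add_assoc]
          by_cases hki : k = i
          · subst hki
            have h₁ := (abs_le.1 (abs_disp_le hA τ k)).1
            have : (C : ℤ) = B + A * L := by simp [hC]
            rw [Pi.add_apply]
            linarith [ht k]
          · exact hτ.le k (by simp [hki, hk])
      have := hmin' _ hcov
      simp only [List.length_append, List.length_take] at this
      omega
    · push Not at hex
      have := hσ.card_le hmin' (C := C) le_rfl fun n hn i hi => hex n (by omega) i hi
      rw [hj] at this
      omega

/-- An exponential function of a fixed power of `S` dominates Rackoff's bound. -/
theorem rackoff_le {S Q A B c : ℕ} (hS : 2 ≤ S) (hQ : Q ≤ 2 ^ S ^ c)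
    (hA : A ≤ 2 ^ S ^ c) (hB : B ≤ 2 ^ S ^ c) (j : ℕ) (hj : j ≤ S) :
    rackoff Q A B j ≤ 2 ^ S ^ (c + 5 * j) := by
  induction j with
  | zero => simpa [rackoff] using hQ
  | succ j ih =>
    have ih := ih (by omega)
    have hm : ∀ {x}, x ≤ 2 ^ S ^ c → x ≤ 2 ^ S ^ (c + 5 * j) := fun h => exp_mono hS h (by omega)
    -- The five units per level pay for the product with `A`, the sum with `B`, the power, the
    -- product with `Q` and the final sum. The power costs only one unit because `j + 1 ≤ S`.
    have hC := exp_add (a := c + 5 * j + 1) hS (exp_mono hS (hm hB) (by omega)) (exp_mul hS (hm hA) ih)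
    have hCp := exp_pow hC (n := j + 1) (b := 1) (by simpa using hj)
    have hQC := exp_mul (a := c + 5 * j + 3) hS (exp_mono hS (hm hQ) (by omega)) hCp
    exact exp_add (a := c + 5 * j + 4) hS hQC (exp_mono hS ih (by omega))

end VASS

/-! ### Small solutions of homogeneous integer systems -/

section IntegerSystems

attribute [local instance] Matrix.seminormedAddCommGroup in
/-- Siegel's lemma in integers. -/
theorem Int.Matrix.exists_ne_zero_abs_le {α β : Type*} [Fintype α] [Fintype β] (A : Matrix α β ℤ)
    (hn : Fintype.card α < Fintype.card β) (hm : 0 < Fintype.card α) {a : ℕ} (ha : 1 ≤ a)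
    (hA : ∀ i j, |A i j| ≤ a) :
    ∃ t : β → ℤ, t ≠ 0 ∧ A.mulVec t = 0 ∧
      ∀ j, |t j| ≤ (Fintype.card β * a) ^ Fintype.card β := by
  obtain ⟨t, ht, hAt, hnorm⟩ := Int.Matrix.exists_ne_zero_int_vec_norm_le A hn hm
  refine ⟨t, ht, hAt, fun j => ?_⟩
  set m := Fintype.card α
  set n := Fintype.card β
  have hAn : ‖A‖ ≤ a := by
    refine (Matrix.norm_le_iff (by positivity)).2 fun i j => ?_
    rw [Int.norm_eq_abs]
    exact_mod_cast hA i j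
  have hmn : (m : ℝ) + 1 ≤ n := by exact_mod_cast hn
  have ha' : (1 : ℝ) ≤ a := by exact_mod_cast ha
  have hn1 : (1 : ℝ) ≤ n := by linarith [(Nat.cast_nonneg m : (0 : ℝ) ≤ m)]
  have hbase : (n : ℝ) * max 1 ‖A‖ ≤ n * a := by gcongr; exact max_le ha' hAn
  have h1 : ‖t‖ ≤ ((n : ℝ) * a) ^ n := by
    refine hnorm.trans ?_
    -- Siegel's exponent $m/(n-m)$ is at most $n$, since $n-m\ge1$ and $m\le n$.
    calc ((n : ℝ) * max 1 ‖A‖) ^ ((m : ℝ) / (n - m)) ≤ (n * a : ℝ) ^ ((m : ℝ) / (n - m)) :=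
          Real.rpow_le_rpow (by positivity) hbase (div_nonneg (by positivity) (by linarith))
      _ ≤ (n * a : ℝ) ^ (n : ℝ) := by
          refine Real.rpow_le_rpow_of_exponent_le (by nlinarith) ?_
          rw [div_le_iff₀ (by linarith)]
          nlinarith
      _ = ((n : ℝ) * a) ^ n := Real.rpow_natCast _ _
  have h2 := (norm_le_pi_norm t j).trans h1
  rw [Int.norm_eq_abs] at h2
  exact_mod_cast h2

variable {V R : Type*} [Fintype V]

theorem sum_eq_sum_subtype {M : Type*} [AddCommMonoid M] (p : V → Prop) [DecidablePred p]
    {f : V → M} (hf : ∀ v, ¬ p v → f v = 0) : ∑ v, f v = ∑ w : {v // p v}, f w := by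
  rw [← Finset.sum_subtype (Finset.univ.filter p) (by simp)]
  exact (Finset.sum_filter_of_ne fun v _ hv => by_contra fun h => hv (hf v h)).symm

open Classical in
/-- A rational solution of a homogeneous system with integer coefficients gives rise to a small
integer solution, supported on the same variables. -/
theorem exists_small_solution_support {row : R → V → ℤ} {a : ℕ} (ha : 1 ≤ a)
    (hrow : ∀ r v, |row r v| ≤ a) {x : V → ℚ} (hx : x ≠ 0)
    (hsol : ∀ r, ∑ v, (row r v : ℚ) * x v = 0) :
    ∃ t : V → ℤ, t ≠ 0 ∧ (∀ v, x v = 0 → t v = 0) ∧ (∀ r, ∑ v, row r v * t v = 0) ∧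
      ∀ v, |t v| ≤ (Fintype.card V * a) ^ Fintype.card V := by
  let W := {v // x v ≠ 0}
  let f : R → W → ℚ := fun r w => row r w
  suffices h : ∃ t : W → ℤ, t ≠ 0 ∧ (∀ r, ∑ w : W, row r w * t w = 0) ∧
      ∀ w, |t w| ≤ (Fintype.card W * a) ^ Fintype.card W by
    obtain ⟨t, ht, hr, hb⟩ := h
    have hW : Fintype.card W ≤ Fintype.card V := Fintype.card_subtype_le _
    refine ⟨fun v => if h : x v ≠ 0 then t ⟨v, h⟩ else 0, ?_, fun v hv => by simp [hv],
      fun r => ?_, fun v => ?_⟩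
    · obtain ⟨w, hw⟩ := Function.ne_iff.1 ht
      refine Function.ne_iff.2 ⟨w, ?_⟩
      simpa [w.2] using hw
    · refine Eq.trans ?_ (hr r)
      rw [sum_eq_sum_subtype (fun v => x v ≠ 0) fun v hv => by simp [hv]]
      exact Finset.sum_congr rfl fun w _ => by simp [w.2]
    · by_cases h : x v ≠ 0
      · simp only [h, not_false_eq_true, ne_eq, dite_true]
        refine (hb ⟨v, h⟩).trans ?_
        have hV : 1 ≤ Fintype.card V := Fintype.card_pos_iff.2 ⟨v⟩
        have : (Fintype.card W * a) ^ Fintype.card W ≤ (Fintype.card V * a) ^ Fintype.card V :=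
          (Nat.pow_le_pow_left (Nat.mul_le_mul_right a hW) _).trans
            (Nat.pow_le_pow_right (Nat.mul_pos hV ha) hW)
        exact_mod_cast this
      · simp only [h, dite_false, abs_zero]
        positivity
  obtain ⟨v₀, hv₀⟩ := Function.ne_iff.1 hx
  -- On its support `W` the vector `x` is nonzero and orthogonal to all rows, so the rows span a
  -- proper subspace. A basis chosen among them has fewer than $|W|$ members, and the possibly
  -- infinite system reduces to those rows.
  have hperp : ∀ g ∈ Submodule.span ℚ (Set.range f), ∑ w : W, g w * x w = 0 := by
    intro g hg
    induction hg using Submodule.span_induction with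
    | mem g hg =>
      obtain ⟨r, rfl⟩ := hg
      refine Eq.trans ?_ (hsol r)
      rw [sum_eq_sum_subtype (fun v => x v ≠ 0) fun v hv => by simp at hv; simp [hv]]
    | zero => simp
    | add g h _ _ hg hh => simp [add_mul, Finset.sum_add_distrib, hg, hh]
    | smul c g _ hg => simp [mul_assoc, ← Finset.mul_sum, hg]
  have hlt : Module.finrank ℚ (Submodule.span ℚ (Set.range f)) < Fintype.card W := by
    rw [← Module.finrank_fintype_fun_eq_card ℚ (η := W)]
    refine Submodule.finrank_lt fun htop => ?_
    have := hperp (Pi.single ⟨v₀, hv₀⟩ 1) (htop ▸ Submodule.mem_top)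
    rw [Finset.sum_eq_single ⟨v₀, hv₀⟩ (fun w _ hw => by simp [hw]) (by simp)] at this
    exact hv₀ (by simpa using this)
  obtain ⟨b, hbf, hspan, hli⟩ := exists_linearIndependent ℚ (Set.range f)
  have hbfin : b.Finite := hli.setFinite
  have : Fintype b := hbfin.fintype
  have hcard : Fintype.card b < Fintype.card W := by
    rw [← hspan, finrank_span_set_eq_card hli] at hlt
    simpa using hlt
  choose ρ hρ using fun g : b => hbf g.2
  have hker : ∀ t : W → ℤ, (∀ g : b, ∑ w : W, row (ρ g) w * t w = 0) →
      ∀ r, ∑ w : W, row r w * t w = 0 := by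
    intro t ht r
    have hmem : f r ∈ Submodule.span ℚ b := hspan ▸ Submodule.subset_span ⟨r, rfl⟩
    have : ∀ g ∈ Submodule.span ℚ b, ∑ w : W, g w * t w = 0 := by
      intro g hg
      induction hg using Submodule.span_induction with
      | mem g hg =>
        have := ht ⟨g, hg⟩
        rw [show g = f (ρ ⟨g, hg⟩) from (hρ ⟨g, hg⟩).symm]
        simp only [f]
        exact_mod_cast this
      | zero => simp
      | add g h _ _ hg hh => simp [add_mul, Finset.sum_add_distrib, hg, hh]
      | smul c g _ hg => simp [mul_assoc, ← Finset.mul_sum, hg]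
    have := this _ hmem
    simp only [f] at this
    exact_mod_cast this
  -- Siegel's lemma needs at least one row. Without any, all restricted rows vanish and a unit
  -- vector is a solution.
  rcases Nat.eq_zero_or_pos (Fintype.card b) with h0 | hpos
  · have : IsEmpty b := Fintype.card_eq_zero_iff.1 h0
    refine ⟨Pi.single ⟨v₀, hv₀⟩ 1, by simp, hker _ fun g => isEmptyElim g, fun w => ?_⟩
    have h1 : (1 : ℤ) ≤ (Fintype.card W * a) ^ Fintype.card W := by
      exact_mod_cast Nat.one_le_pow _ _ (Nat.mul_pos (h0 ▸ hcard) ha)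
    refine le_trans ?_ h1
    rw [Pi.single_apply]
    split_ifs <;> simp
  · obtain ⟨t, ht, hAt, hb⟩ := Int.Matrix.exists_ne_zero_abs_le
      (A := fun (g : b) (w : W) => row (ρ g) w) hcard hpos ha fun g w => hrow _ _
    exact ⟨t, ht, hker t fun g => congrFun hAt g, hb⟩

/-- One step of the decomposition of a nonnegative rational solution: a small nonnegative integer
solution is supported on the support of the given one. -/
theorem exists_small_nonneg_support {row : R → V → ℤ} {a : ℕ} (ha : 1 ≤ a)
    (hrow : ∀ r v, |row r v| ≤ a) {x : V → ℚ} (hx : x ≠ 0) (hx0 : 0 ≤ x)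
    (hsol : ∀ r, ∑ v, (row r v : ℚ) * x v = 0) :
    ∃ t : V → ℤ, t ≠ 0 ∧ 0 ≤ t ∧ (∀ v, x v = 0 → t v = 0) ∧ (∀ r, ∑ v, row r v * t v = 0) ∧
      ∀ v, t v ≤ (Fintype.card V * a) ^ Fintype.card V := by
  classical
  induction hn : (Finset.univ.filter fun v => x v ≠ 0).card using Nat.strong_induction_on
    generalizing x with
  | _ n ih =>
  subst hn
  obtain ⟨t, ht, hsupp, hker, hbd⟩ := exists_small_solution_support ha hrow hx hsol
  by_cases hpos : 0 ≤ t
  · exact ⟨t, ht, hpos, hsupp, hker, fun v => (le_abs_self _).trans (hbd v)⟩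
  by_cases hneg : t ≤ 0
  · refine ⟨-t, neg_ne_zero.2 ht, neg_nonneg.2 hneg, fun v hv => by simp [hsupp v hv],
      fun r => by simpa using hker r, fun v => (neg_le_abs _).trans (hbd v)⟩
  obtain ⟨p, hp⟩ : ∃ v, 0 < t v := by
    by_contra! h
    exact hneg h
  obtain ⟨q, hq⟩ : ∃ v, t v < 0 := by
    by_contra! h
    exact hpos h
  -- For `t` of mixed sign, subtract the largest multiple of `t` that keeps `x` nonnegative. The
  -- coordinate `w` drops out of the support, while the coordinate `q` with `t q < 0` stays
  -- positive, so the induction on the support continues with a nonzero vector.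
  obtain ⟨w, hw, hmin⟩ := Finset.exists_min_image (Finset.univ.filter fun v => 0 < t v)
    (fun v => x v / t v) ⟨p, by simpa using hp⟩
  simp only [Finset.mem_filter, Finset.mem_univ, true_and] at hw hmin
  set c := x w / t w with hc
  have hw' : (0 : ℚ) < t w := by exact_mod_cast hw
  have hc0 : 0 ≤ c := div_nonneg (hx0 w) hw'.le
  have hxw : x w - c * t w = 0 := by rw [hc, div_mul_cancel₀ _ hw'.ne', sub_self]
  have hlt : (Finset.univ.filter fun v => x v - c * t v ≠ 0).card <
      (Finset.univ.filter fun v => x v ≠ 0).card := by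
    refine Finset.card_lt_card (Finset.ssubset_iff_of_subset (fun v hv => ?_) |>.2 ⟨w, ?_, ?_⟩)
    · simp only [Finset.mem_filter, Finset.mem_univ, true_and] at hv ⊢
      intro h
      exact hv (by simp [h, hsupp v h])
    · simp only [Finset.mem_filter, Finset.mem_univ, true_and]
      intro h
      exact hw.ne' (hsupp w h)
    · simp [hxw]
  have hne : (fun v => x v - c * t v) ≠ 0 := by
    have hq' : (t q : ℚ) < 0 := by exact_mod_cast hq
    have hxq : 0 < x q := (hx0 q).lt_of_ne fun h => hq.ne (hsupp q h.symm)
    have : 0 < x q - c * t q := by nlinarith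
    exact Function.ne_iff.2 ⟨q, by simpa using this.ne'⟩
  have hnn : (0 : V → ℚ) ≤ fun v => x v - c * t v := by
    intro v
    change (0 : ℚ) ≤ x v - c * t v
    rcases le_or_gt (t v) 0 with h | h
    · have h' : (t v : ℚ) ≤ 0 := by exact_mod_cast h
      have := hx0 v
      simp only [Pi.zero_apply] at this
      nlinarith
    · have h' : (0 : ℚ) < t v := by exact_mod_cast h
      have := (le_div_iff₀ h').1 (hmin v h)
      linarith
  have hsol' : ∀ r, ∑ v, (row r v : ℚ) * (x v - c * t v) = 0 := by
    intro r
    have : ∑ v, (row r v : ℚ) * t v = 0 := by exact_mod_cast hker r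
    simp only [mul_sub, Finset.sum_sub_distrib, hsol r, mul_left_comm _ c, ← Finset.mul_sum, this,
      mul_zero, sub_zero]
  obtain ⟨s, hs, hs0, hss, hsk, hsb⟩ := ih _ hlt hne hnn hsol' rfl
  exact ⟨s, hs, hs0, fun v hv => hss v (by simp [hv, hsupp v hv]), hsk, hsb⟩

/-- A nonnegative solution of a homogeneous system is small, or it lies above a small nonzero
integer solution. -/
theorem exists_small_below_or_small {row : R → V → ℤ} {a : ℕ} (ha : 1 ≤ a)
    (hrow : ∀ r v, |row r v| ≤ a) {x : V → ℚ} (hx0 : 0 ≤ x)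
    (hsol : ∀ r, ∑ v, (row r v : ℚ) * x v = 0) :
    (∃ t : V → ℤ, t ≠ 0 ∧ 0 ≤ t ∧ (∀ v, (t v : ℚ) ≤ x v) ∧ (∀ r, ∑ v, row r v * t v = 0) ∧
      ∀ v, t v ≤ (Fintype.card V * a) ^ Fintype.card V) ∨
    ∀ v, x v ≤ Fintype.card V * (Fintype.card V * a) ^ Fintype.card V := by
  classical
  set M : ℕ := (Fintype.card V * a) ^ Fintype.card V with hM
  -- The bound is sharpened to the size of the support times $M$: each subtraction below removes at
  -- least one coordinate from the support and takes away at most $M$ from every entry.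
  suffices h : (∃ t : V → ℤ, t ≠ 0 ∧ 0 ≤ t ∧ (∀ v, (t v : ℚ) ≤ x v) ∧
      (∀ r, ∑ v, row r v * t v = 0) ∧ ∀ v, t v ≤ (Fintype.card V * a) ^ Fintype.card V) ∨
      ∀ v, x v ≤ (Finset.univ.filter fun v => x v ≠ 0).card * M by
    refine h.imp_right fun h v => (h v).trans ?_
    have : (Finset.univ.filter fun v => x v ≠ 0).card * M ≤ Fintype.card V * M :=
      Nat.mul_le_mul_right _ (Finset.card_le_univ _)
    exact_mod_cast this
  induction hn : (Finset.univ.filter fun v => x v ≠ 0).card using Nat.strong_induction_on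
    generalizing x with
  | _ n ih =>
  rcases eq_or_ne x 0 with rfl | hx
  · exact Or.inr fun v => by simp; positivity
  obtain ⟨t, ht, ht0, hsupp, hker, hbd⟩ := exists_small_nonneg_support ha hrow hx hx0 hsol
  obtain ⟨p, hp⟩ : ∃ v, 0 < t v := by
    by_contra! h
    exact ht (le_antisymm h ht0)
  obtain ⟨w, hw, hmin⟩ := Finset.exists_min_image (Finset.univ.filter fun v => 0 < t v)
    (fun v => x v / t v) ⟨p, by simpa using hp⟩
  simp only [Finset.mem_filter, Finset.mem_univ, true_and] at hw hmin
  set c := x w / t w with hc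
  have hw' : (0 : ℚ) < t w := by exact_mod_cast hw
  have hc0 : 0 ≤ c := div_nonneg (hx0 w) hw'.le
  have hxw : x w - c * t w = 0 := by rw [hc, div_mul_cancel₀ _ hw'.ne', sub_self]
  have ht0' : ∀ v, (0 : ℚ) ≤ t v := fun v => by exact_mod_cast ht0 v
  have hle : ∀ v, c * t v ≤ x v := by
    intro v
    rcases (ht0 v).eq_or_lt with h | h
    · have := hx0 v
      simp only [Pi.zero_apply] at this h
      simpa [← h] using this
    · have h' : (0 : ℚ) < t v := by exact_mod_cast h
      exact (le_div_iff₀ h').1 (hmin v h)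
  -- If the multiple that can be subtracted is at least one, then already `t ≤ x`; otherwise the
  -- subtracted part `c • t` is itself small.
  rcases le_or_gt 1 c with h1 | h1
  · exact Or.inl ⟨t, ht, ht0, fun v => by nlinarith [hle v, ht0' v], hker, hbd⟩
  have hlt : (Finset.univ.filter fun v => x v - c * t v ≠ 0).card < n := by
    rw [← hn]
    refine Finset.card_lt_card (Finset.ssubset_iff_of_subset (fun v hv => ?_) |>.2 ⟨w, ?_, ?_⟩)
    · simp only [Finset.mem_filter, Finset.mem_univ, true_and] at hv ⊢
      intro h
      exact hv (by simp [h, hsupp v h])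
    · simp only [Finset.mem_filter, Finset.mem_univ, true_and]
      intro h
      exact hw.ne' (hsupp w h)
    · simp [hxw]
  have hsol' : ∀ r, ∑ v, (row r v : ℚ) * (x v - c * t v) = 0 := by
    intro r
    have : ∑ v, (row r v : ℚ) * t v = 0 := by exact_mod_cast hker r
    simp only [mul_sub, Finset.sum_sub_distrib, hsol r, mul_left_comm _ c, ← Finset.mul_sum, this,
      mul_zero, sub_zero]
  rcases ih _ hlt (fun v => sub_nonneg.2 (hle v)) hsol' rfl with ⟨s, hs, hs0, hsx, hsk, hsb⟩ | h
  · exact Or.inl ⟨s, hs, hs0, fun v => (hsx v).trans (by nlinarith [hle v, ht0' v]), hsk, hsb⟩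
  · refine Or.inr fun v => ?_
    have h₁ := h v
    have h₂ : (t v : ℚ) ≤ M := by rw [hM]; exact_mod_cast hbd v
    have h₃ : ((Finset.univ.filter fun v => x v - c * t v ≠ 0).card : ℚ) + 1 ≤ n := by
      exact_mod_cast hlt
    have h₄ : (0 : ℚ) ≤ M := by positivity
    have h₅ := mul_le_mul_of_nonneg_right h₃ h₄
    have h₆ := mul_le_mul_of_nonneg_right h1.le (ht0' v)
    linarith

end IntegerSystems

/-! ### Bounds for minimal solutions -/

section MinimalSolutions

variable {V R I : Type*} [Fintype V] [Fintype I]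

/-- The value `z` at the homogenizing variable, and `x` elsewhere. -/
def homVec (x : V → ℤ) (z : ℤ) : Option V → ℤ := fun o => o.elim z x

/-- A linear functional is `a`-bounded on the unit cube. -/
def IsBddBy {U : Type*} (L : (U → ℤ) →ₗ[ℤ] ℤ) (a : ℕ) : Prop :=
  ∀ f : U → ℤ, (∀ u, |f u| ≤ 1) → |L f| ≤ a

/-- Coefficients are values at unit vectors, so an estimate on the unit cube bounds all of them
without expanding the functional. -/
theorem IsBddBy.abs_single_le {U : Type*} [DecidableEq U] {L : (U → ℤ) →ₗ[ℤ] ℤ} {a : ℕ}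
    (h : IsBddBy L a) (u : U) : |L (fun w => if u = w then 1 else 0)| ≤ a :=
  h _ fun w => by split_ifs <;> simp

theorem sum_single_mul {U : Type*} [Fintype U] [DecidableEq U] (L : (U → ℤ) →ₗ[ℤ] ℤ) (f : U → ℤ) :
    ∑ u, L (fun w => if u = w then 1 else 0) * f u = L f := by
  rw [LinearMap.pi_apply_eq_sum_univ L f]
  exact Finset.sum_congr rfl fun u _ => by rw [smul_eq_mul, mul_comm]

/-- The minimal nonzero solutions of a homogeneous system are small. -/
theorem minimal_homogeneous_le {L : R → (V → ℤ) →ₗ[ℤ] ℤ} {a : ℕ} (ha : 1 ≤ a)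
    (hL : ∀ r, IsBddBy (L r) a) {x : V → ℕ} (hx : ∀ r, L r (fun v => x v) = 0)
    (hmin : ∀ y : V → ℕ, y ≠ 0 → y ≤ x → (∀ r, L r (fun v => y v) = 0) → y = x) (v : V) :
    x v ≤ Fintype.card V * (Fintype.card V * a) ^ Fintype.card V := by
  classical
  have hsol : ∀ r, ∑ v, ((L r (fun w => if v = w then 1 else 0) : ℤ) : ℚ) * (x v : ℚ) = 0 := by
    intro r
    have := (sum_single_mul (L r) fun v => (x v : ℤ)).trans (hx r)
    exact_mod_cast this
  rcases exists_small_below_or_small ha (fun r v => (hL r).abs_single_le v)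
    (x := fun v => (x v : ℚ)) (fun v => Nat.cast_nonneg _) hsol with ⟨t, ht, ht0, htx, hker, hbd⟩ | h
  · have hcast : ∀ v, ((t v).toNat : ℤ) = t v := fun v => Int.toNat_of_nonneg (ht0 v)
    have hyx := hmin (fun v => (t v).toNat) (fun h0 => ht (funext fun v => by
        rw [← hcast v, congrFun h0 v]; rfl))
      (fun v => by
        have h₁ : t v ≤ x v := by exact_mod_cast htx v
        have h₂ := hcast v
        show (t v).toNat ≤ x v
        omega)
      (fun r => by simp only [hcast]; rw [← sum_single_mul]; exact hker r)
    have h₁ := hbd v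
    rw [← hcast v, congrFun hyx v] at h₁
    have h₂ : x v ≤ (Fintype.card V * a) ^ Fintype.card V := by exact_mod_cast h₁
    exact h₂.trans (Nat.le_mul_of_pos_left _ (Fintype.card_pos_iff.2 ⟨v⟩))
  · exact_mod_cast h v

/-- The minimal solutions of an inhomogeneous system of equations and inequalities are small. -/
theorem minimal_inhomogeneous_le {L : R → (Option V → ℤ) →ₗ[ℤ] ℤ} {K : I → (Option V → ℤ) →ₗ[ℤ] ℤ}
    {a : ℕ} (ha : 1 ≤ a) (hL : ∀ r, IsBddBy (L r) a) (hK : ∀ i, IsBddBy (K i) a) {x : V → ℕ}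
    (hx : ∀ r, L r (homVec (fun v => x v) 1) = 0) (hx' : ∀ i, 0 ≤ K i (homVec (fun v => x v) 1))
    (hmin : ∀ y : V → ℕ, y ≤ x → (∀ r, L r (homVec (fun v => y v) 1) = 0) →
      (∀ i, 0 ≤ K i (homVec (fun v => y v) 1)) → y = x) (v : V) :
    x v ≤ Fintype.card (Option V ⊕ I) * (Fintype.card (Option V ⊕ I) * a) ^
      Fintype.card (Option V ⊕ I) := by
  classical
  -- The system is made homogeneous by the variable `none`, set to $1$, and each inequality becomes
  -- an equation by a slack variable with coefficient $-1$.
  let row : R ⊕ I → Option V ⊕ I → ℤ := Sum.elim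
    (fun r => Sum.elim (fun o => L r (fun w => if o = w then 1 else 0)) 0)
    (fun i => Sum.elim (fun o => K i (fun w => if o = w then 1 else 0))
      (fun j => if i = j then -1 else 0))
  have hrow : ∀ r v, |row r v| ≤ a := by
    have ha' : (1 : ℤ) ≤ a := by exact_mod_cast ha
    rintro (r | i) (o | j)
    · exact (hL r).abs_single_le o
    · simp [row]
    · exact (hK i).abs_single_le o
    · simp only [row, Sum.elim_inr]
      split_ifs
      · simpa using ha'
      · simp
  have hsumL : ∀ r (t : Option V ⊕ I → ℤ), ∑ u, row (Sum.inl r) u * t u = L r (t ∘ Sum.inl) := by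
    intro r t
    rw [Fintype.sum_sum_type, ← sum_single_mul (L r)]
    simp [row]
  have hsumK : ∀ i (t : Option V ⊕ I → ℤ), ∑ u, row (Sum.inr i) u * t u =
      K i (t ∘ Sum.inl) - t (Sum.inr i) := by
    intro i t
    rw [Fintype.sum_sum_type, ← sum_single_mul (K i)]
    simp [row, sub_eq_add_neg]
  let s : Option V ⊕ I → ℤ := Sum.elim (homVec (fun v => x v) 1)
    (fun i => K i (homVec (fun v => x v) 1))
  have hs0 : ∀ u, 0 ≤ s u := by
    rintro ((_ | v) | i)
    · simp [s, homVec]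
    · simp [s, homVec]
    · exact hx' i
  have hsol : ∀ r, ∑ u, (row r u : ℚ) * (s u : ℚ) = 0 := by
    rintro (r | i)
    · have := (hsumL r s).trans (hx r)
      exact_mod_cast this
    · have := (hsumK i s).trans (sub_self _)
      exact_mod_cast this
  rcases exists_small_below_or_small ha hrow (x := fun u => (s u : ℚ))
    (fun u => by show (0 : ℚ) ≤ s u; exact_mod_cast hs0 u) hsol with ⟨t, ht, ht0, hts, hker, hbd⟩ | h
  · replace hts : ∀ u, t u ≤ s u := fun u => by exact_mod_cast hts u
    have hkL : ∀ r, L r (t ∘ Sum.inl) = 0 := fun r => (hsumL r t).symm.trans (hker _)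
    have hkK : ∀ i, K i (t ∘ Sum.inl) = t (Sum.inr i) := fun i =>
      sub_eq_zero.1 ((hsumK i t).symm.trans (hker _))
    have htz : t (Sum.inl none) ≤ 1 := hts (Sum.inl none)
    have htz0 := ht0 (Sum.inl none)
    simp only [Pi.zero_apply] at htz0
    have htv : ∀ v, t (Sum.inl (some v)) ≤ x v := fun v => hts (Sum.inl (some v))
    have htv0 : ∀ v, 0 ≤ t (Sum.inl (some v)) := fun v => ht0 _
    have hvec : t ∘ Sum.inl = homVec (fun v => t (Sum.inl (some v))) (t (Sum.inl none)) := by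
      ext o; cases o <;> rfl
    -- A small solution `t` below the given one has homogenizing value $0$ or $1$. If it is $0$,
    -- subtracting `t` leaves a solution (the slacks of `t` are also below), so minimality makes `t`
    -- vanish. If it is $1$, then `t` solves the original system and equals `x` by minimality.
    obtain hz | hz : t (Sum.inl none) = 0 ∨ t (Sum.inl none) = 1 := by omega
    · exfalso
      have hy : homVec (fun v => ((x v - (t (Sum.inl (some v))).toNat : ℕ) : ℤ)) 1 =
          homVec (fun v => (x v : ℤ)) 1 - t ∘ Sum.inl := by
        ext o
        rcases o with _ | v
        · simp [homVec, hz]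
        · have := htv v
          have := htv0 v
          simp only [homVec, Option.elim, Pi.sub_apply, Function.comp]
          omega
      have := hmin (fun v => x v - (t (Sum.inl (some v))).toNat) (fun v => Nat.sub_le _ _)
        (fun r => by rw [hy, map_sub, hx r, hkL r, sub_zero])
        (fun i => by rw [hy, map_sub, hkK i]; exact sub_nonneg.2 (hts (Sum.inr i)))
      have h0 : t ∘ Sum.inl = 0 := by
        ext o
        rcases o with _ | v
        · exact hz
        · have h₁ := congrFun this v
          have := htv v
          have := htv0 v
          simp only [Function.comp, Pi.zero_apply] at *
          omega
      refine ht (funext fun u => ?_)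
      rcases u with o | i
      · exact congrFun h0 o
      · rw [← hkK i, h0, map_zero]; rfl
    · have hcast : ∀ v, ((t (Sum.inl (some v))).toNat : ℤ) = t (Sum.inl (some v)) := fun v =>
        Int.toNat_of_nonneg (htv0 v)
      have hyx := hmin (fun v => (t (Sum.inl (some v))).toNat)
        (fun v => by
          have h₁ := htv v
          have h₂ := hcast v
          show (t (Sum.inl (some v))).toNat ≤ x v
          omega)
        (fun r => by simp only [hcast]; rw [← hkL r, hvec, hz])
        (fun i => by simp only [hcast]; rw [← hz, ← hvec, hkK i]; exact ht0 _)
      have h₁ := hbd (Sum.inl (some v))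
      rw [← hcast v, congrFun hyx v] at h₁
      have h₂ : x v ≤ (Fintype.card (Option V ⊕ I) * a) ^ Fintype.card (Option V ⊕ I) := by
        exact_mod_cast h₁
      exact h₂.trans (Nat.le_mul_of_pos_left _ (Fintype.card_pos_iff.2 ⟨Sum.inl none⟩))
  · have := h (Sum.inl (some v))
    simp only [s, Sum.elim_inl, homVec, Option.elim] at this
    exact_mod_cast this

end MinimalSolutions

/-! ### Encoding lengths, circular graphs and laps -/

namespace VASS

variable {D : ℕ}

theorem lt_two_pow_natBits (n : ℕ) : n < 2 ^ natBits n :=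
  (Nat.lt_size_self n).trans_le (Nat.pow_le_pow_right (by norm_num) (le_max_right _ _))

theorem one_le_natBits (n : ℕ) : 1 ≤ natBits n := le_max_left _ _

theorem le_two_pow_of_natBits_le {n S : ℕ} (h : natBits n ≤ S) : n ≤ 2 ^ S :=
  (lt_two_pow_natBits n).le.trans (Nat.pow_le_pow_right (by norm_num) h)

theorem abs_le_two_pow_of_vecBits_le {t : Fin D → ℤ} {S : ℕ} (h : vecBits t ≤ S) (i : Fin D) :
    |t i| ≤ (2 ^ S : ℕ) := by
  have h₁ : 1 + natBits (t i).natAbs ≤ vecBits t :=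
    Finset.single_le_sum (f := fun i => 1 + natBits (t i).natAbs) (fun _ _ => Nat.zero_le _)
      (Finset.mem_univ i)
  have := le_two_pow_of_natBits_le (n := (t i).natAbs) (S := S) (by omega)
  rw [Int.abs_eq_natAbs]
  exact_mod_cast this

theorem numStates_le_size (G : VASS D) : G.numStates ≤ G.size :=
  (Nat.le_mul_of_pos_right _ (one_le_natBits _)).trans (Nat.le_add_right _ _)

theorem numTrans_le_size (G : VASS D) : G.numTrans ≤ G.size := by
  have : ∑ e : G.Trans, 1 ≤ ∑ e, (2 * natBits G.numStates + vecBits (G.label e)) :=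
    Finset.sum_le_sum fun e _ => by have := one_le_natBits G.numStates; omega
  simp only [Finset.sum_const, Finset.card_univ, Fintype.card_fin, smul_eq_mul, mul_one] at this
  exact this.trans (Nat.le_add_left _ _)

theorem vecBits_label_le_size (G : VASS D) (e : G.Trans) : vecBits (G.label e) ≤ G.size := by
  have : 2 * natBits G.numStates + vecBits (G.label e) ≤
      ∑ e, (2 * natBits G.numStates + vecBits (G.label e)) :=
    Finset.single_le_sum (f := fun e => 2 * natBits G.numStates + vecBits (G.label e))
      (fun _ _ => Nat.zero_le _) (Finset.mem_univ e)
  rw [size]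
  omega

/-! ### Circular graphs -/

variable {G : VASS D}

/-- Outgoing edges are unique, so a path is determined by its start and its length. -/
theorem Circular.eq_of_isPath (hG : G.Circular) {p q q' : G.State} {π σ : List G.Trans}
    (hπ : G.IsPath p π q) (hσ : G.IsPath p σ q') (hlen : π.length = σ.length) : π = σ := by
  induction π generalizing p σ with
  | nil => exact (List.length_eq_zero_iff.1 hlen.symm).symm
  | cons e π ih =>
    cases σ with
    | nil => simp at hlen
    | cons f σ =>
      obtain rfl := (hG.2.2.1 p).unique hπ.1 hσ.1
      rw [ih hπ.2 hσ.2 (by simpa using hlen)]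

theorem Circular.bdry_apply_tgt (hG : G.Circular) (ψ : G.Trans → ℕ) {e f : G.Trans}
    (h : G.tgt e = G.src f) : G.bdry ψ (G.tgt e) = ψ e - ψ f := by
  have h₁ : (Finset.univ.filter fun e' => G.tgt e' = G.tgt e) = {e} := by
    ext e'
    simp only [Finset.mem_filter, Finset.mem_univ, true_and, Finset.mem_singleton]
    exact ⟨fun h' => (hG.2.2.2 _).unique h' rfl, fun h' => h' ▸ rfl⟩
  have h₂ : (Finset.univ.filter fun e' => G.src e' = G.tgt e) = {f} := by
    ext e'
    simp only [Finset.mem_filter, Finset.mem_univ, true_and, Finset.mem_singleton]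
    exact ⟨fun h' => (hG.2.2.1 _).unique h' h.symm, fun h' => h' ▸ h.symm⟩
  rw [bdry_apply, h₁, h₂, Finset.sum_singleton, Finset.sum_singleton]

/-- A circulation on a circular graph is constant. -/
theorem Circular.eq_of_bdry_eq_zero (hG : G.Circular) {ψ : G.Trans → ℕ} (hψ : G.bdry ψ = 0)
    (e f : G.Trans) : ψ e = ψ f := by
  have key : ∀ π (e f : G.Trans), G.IsPath (G.src e) π (G.src f) → ψ e = ψ f := by
    intro π
    induction π with
    | nil => exact fun e f h => by rw [(hG.2.2.1 _).unique (h : G.src e = G.src f) rfl]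
    | cons g π ih =>
      intro e f h
      obtain rfl := (hG.2.2.1 _).unique h.1 rfl
      obtain ⟨g', hg', -⟩ := hG.2.2.1 (G.tgt g)
      rw [← ih g' f (hg' ▸ h.2)]
      have := hG.bdry_apply_tgt ψ hg'.symm
      rw [hψ, Pi.zero_apply] at this
      omega
  obtain ⟨π, hπ⟩ := hG.1 (G.src e) (G.src f)
  exact key π e f hπ

theorem Circular.bdry_one (hG : G.Circular) : G.bdry 1 = 0 := by
  ext s
  obtain ⟨e, rfl, -⟩ := hG.2.2.2 s
  obtain ⟨f, hf, -⟩ := hG.2.2.1 (G.tgt e)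
  rw [hG.bdry_apply_tgt 1 hf.symm]
  simp

end VASS

namespace ConstraintGraph

variable {D : ℕ} {X : ConstraintGraph D}

open VASS

/-- On a circular graph the constant $1$ is a positive circulation; a lap is an Eulerian circuit for
it. -/
theorem IsLinear.exists_isLap (h : X.IsLinear) : ∃ π, X.IsLap π := by
  obtain ⟨π, hπ, hc⟩ := X.stronglyConnected.exists_eulerian_path (ψ := 1) (p := X.entry)
    (q := X.entry) (fun _ => Nat.one_pos) (by rw [h.2.bdry_one, sub_self])
  exact ⟨π, hπ, fun e => congrFun hc e⟩

theorem IsLap.parikh_eq {π : List X.Trans} (h : X.IsLap π) : parikh π = 1 := funext h.2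

theorem IsLap.length_eq {π : List X.Trans} (h : X.IsLap π) : π.length = X.numTrans := by
  rw [length_eq_sum_parikh, h.parikh_eq]
  simp

open Classical in
/-- The lap of a linear constraint graph, the empty path for other constraint graphs. -/
noncomputable def lap (X : ConstraintGraph D) : List X.Trans :=
  if h : X.IsLinear then h.exists_isLap.choose else []

theorem IsLinear.isLap_lap (h : X.IsLinear) : X.IsLap X.lap := by
  rw [lap, dif_pos h]
  exact h.exists_isLap.choose_spec

/-- The lap constraints quantify over all laps; uniqueness turns them into finitely many linear
inequalities. -/
theorem IsLinear.eq_lap (h : X.IsLinear) {π : List X.Trans} (hπ : X.IsLap π) : π = X.lap :=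
  h.2.eq_of_isPath hπ.1 h.isLap_lap.1 (by rw [hπ.length_eq, h.isLap_lap.length_eq])

theorem length_lap_le (X : ConstraintGraph D) : X.lap.length ≤ X.numTrans := by
  by_cases h : X.IsLinear
  · exact h.isLap_lap.length_eq.le
  · simp [lap, h]

end ConstraintGraph

/-! ### Parameters bounded by the instance size -/

namespace CGS

variable {D : ℕ} (ξ : CGS D) (a b : Fin D → ℕ)

open VASS

/-- The two spare units encode the entry and the exit state. They also give $S\ge2$, which the
exponent calculus requires. -/
theorem comp_size_le (j : Fin (ξ.k + 1)) : (ξ.comp j).toVASS.size + 2 ≤ ξ.instSize a b := by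
  have h₁ : (ξ.comp j).size ≤ ∑ j, (ξ.comp j).size :=
    Finset.single_le_sum (f := fun j => (ξ.comp j).size) (fun _ _ => Nat.zero_le _)
      (Finset.mem_univ j)
  have h₂ := one_le_natBits (ξ.comp j).numStates
  simp only [instSize, size]
  rw [ConstraintGraph.size] at h₁
  omega

theorem two_le_instSize : 2 ≤ ξ.instSize a b := by
  have := ξ.comp_size_le a b 0
  omega

theorem k_lt_instSize : ξ.k + 1 ≤ ξ.instSize a b := by
  have : ∑ j : Fin (ξ.k + 1), 1 ≤ ∑ j, (ξ.comp j).size := Finset.sum_le_sum fun j _ => by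
    have := one_le_natBits (ξ.comp j).numStates
    rw [ConstraintGraph.size]
    omega
  simp only [Finset.sum_const, Finset.card_univ, Fintype.card_fin, smul_eq_mul, mul_one] at this
  simp only [instSize, size]
  omega

theorem sum_numTrans_le : ∑ j, (ξ.comp j).numTrans ≤ ξ.instSize a b := by
  have : ∑ j, (ξ.comp j).numTrans ≤ ∑ j, (ξ.comp j).size := Finset.sum_le_sum fun j _ => by
    have := numTrans_le_size (ξ.comp j).toVASS
    rw [ConstraintGraph.size]
    omega
  simp only [instSize, size]
  omega

theorem numTrans_le (j : Fin (ξ.k + 1)) : (ξ.comp j).numTrans ≤ ξ.instSize a b := by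
  have := numTrans_le_size (ξ.comp j).toVASS
  have := ξ.comp_size_le a b j
  omega

theorem numStates_le (j : Fin (ξ.k + 1)) : (ξ.comp j).numStates ≤ ξ.instSize a b := by
  have := numStates_le_size (ξ.comp j).toVASS
  have := ξ.comp_size_le a b j
  omega

theorem dim_le_instSize : D ≤ ξ.instSize a b := by
  have : ∑ i : Fin D, 1 ≤ ∑ i, natBits (a i) := Finset.sum_le_sum fun i _ => one_le_natBits _
  simp only [Finset.sum_const, Finset.card_univ, Fintype.card_fin, smul_eq_mul, mul_one] at this
  rw [instSize]
  omega

theorem abs_label_le (j : Fin (ξ.k + 1)) (e : (ξ.comp j).Trans) (i : Fin D) :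
    |(ξ.comp j).label e i| ≤ (2 ^ ξ.instSize a b : ℕ) :=
  abs_le_two_pow_of_vecBits_le ((vecBits_label_le_size _ e).trans (by
    have := ξ.comp_size_le a b j
    omega)) i

theorem abs_conn_le (j : Fin ξ.k) (i : Fin D) : |ξ.conn j i| ≤ (2 ^ ξ.instSize a b : ℕ) := by
  refine abs_le_two_pow_of_vecBits_le ?_ i
  have : vecBits (ξ.conn j) ≤ ∑ j, vecBits (ξ.conn j) :=
    Finset.single_le_sum (f := fun j => vecBits (ξ.conn j)) (fun _ _ => Nat.zero_le _)
      (Finset.mem_univ j)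
  simp only [instSize, size]
  omega

theorem start_le (i : Fin D) : a i ≤ 2 ^ ξ.instSize a b := by
  refine le_two_pow_of_natBits_le ?_
  have : natBits (a i) ≤ ∑ i, natBits (a i) :=
    Finset.single_le_sum (f := fun i => natBits (a i)) (fun _ _ => Nat.zero_le _)
      (Finset.mem_univ i)
  rw [instSize]
  omega

theorem finish_le (i : Fin D) : b i ≤ 2 ^ ξ.instSize a b := by
  refine le_two_pow_of_natBits_le ?_
  have : natBits (b i) ≤ ∑ i, natBits (b i) :=
    Finset.single_le_sum (f := fun i => natBits (b i)) (fun _ _ => Nat.zero_le _)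
      (Finset.mem_univ i)
  rw [instSize]
  omega

end CGS

/-! ### The characteristic system as a linear system -/

namespace CGS

variable {D : ℕ} (ξ : CGS D)

open VASS

/-- The scalar variables of the characteristic system. -/
abbrev Var : Type :=
  (Fin (ξ.k + 1) × Fin D) ⊕ (Fin (ξ.k + 1) × Fin D) ⊕ Σ j, (ξ.comp j).Trans

/-- The entry location variable. -/
abbrev Var.x {ξ : CGS D} (j : Fin (ξ.k + 1)) (i : Fin D) : ξ.Var := Sum.inl (j, i)

/-- The exit location variable. -/
abbrev Var.y {ξ : CGS D} (j : Fin (ξ.k + 1)) (i : Fin D) : ξ.Var := Sum.inr (Sum.inl (j, i))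

/-- The multiplicity variable. -/
abbrev Var.psi {ξ : CGS D} (j : Fin (ξ.k + 1)) (e : (ξ.comp j).Trans) : ξ.Var :=
  Sum.inr (Sum.inr ⟨j, e⟩)

/-- Assignments as functions on the scalar variables. -/
def coords : ξ.Assignment ≃o (ξ.Var → ℕ) where
  toFun m := Sum.elim (fun u => m.x u.1 u.2)
    (Sum.elim (fun u => m.y u.1 u.2) (fun u => m.psi u.1 u.2))
  invFun f := (fun j i => f (Var.x j i), fun j i => f (Var.y j i), fun j e => f (Var.psi j e))
  left_inv m := rfl
  right_inv f := by ext (u | u | u) <;> rfl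
  map_rel_iff' := by
    intro m m'
    constructor
    · intro h
      exact ⟨fun j i => h (Var.x j i), fun j i => h (Var.y j i), fun j e => h (Var.psi j e)⟩
    · rintro ⟨hx, hy, hψ⟩ (u | u | u)
      · exact hx u.1 u.2
      · exact hy u.1 u.2
      · exact hψ u.1 u.2

@[simp] theorem coords_x (m : ξ.Assignment) (j : Fin (ξ.k + 1)) (i : Fin D) :
    ξ.coords m (Var.x j i) = m.x j i := rfl

@[simp] theorem coords_y (m : ξ.Assignment) (j : Fin (ξ.k + 1)) (i : Fin D) :
    ξ.coords m (Var.y j i) = m.y j i := rfl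

@[simp] theorem coords_psi (m : ξ.Assignment) (j : Fin (ξ.k + 1)) (e : (ξ.comp j).Trans) :
    ξ.coords m (Var.psi j e) = m.psi j e := rfl

/-- The equations of the characteristic system. -/
inductive Row : Type
  | euler (j : Fin (ξ.k + 1)) (s : (ξ.comp j).State)
  | disp (j : Fin (ξ.k + 1)) (i : Fin D)
  | conn (j : Fin ξ.k) (i : Fin D)
  | start (i : Fin D)
  | finish (i : Fin D)

/-- Coordinate functionals. -/
abbrev pr {ξ : CGS D} (o : Option ξ.Var) : (Option ξ.Var → ℤ) →ₗ[ℤ] ℤ := LinearMap.proj o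

/-- The homogenized equations. -/
def eqn (a b : Fin D → ℕ) : ξ.Row → (Option ξ.Var → ℤ) →ₗ[ℤ] ℤ
  | .euler j s =>
      ∑ e, ((Pi.single ((ξ.comp j).tgt e) 1 : (ξ.comp j).State → ℤ) s -
        (Pi.single ((ξ.comp j).src e) 1 : (ξ.comp j).State → ℤ) s) • pr (some (Var.psi j e)) -
      ((Pi.single (ξ.comp j).exit 1 : (ξ.comp j).State → ℤ) s -
        (Pi.single (ξ.comp j).entry 1 : (ξ.comp j).State → ℤ) s) • pr none
  | .disp j i => pr (some (Var.x j i)) +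
      ∑ e, (ξ.comp j).label e i • pr (some (Var.psi j e)) - pr (some (Var.y j i))
  | .conn j i => pr (some (Var.y j.castSucc i)) + ξ.conn j i • pr none -
      pr (some (Var.x j.succ i))
  | .start i => pr (some (Var.x 0 i)) - (a i : ℤ) • pr none
  | .finish i => pr (some (Var.y (Fin.last ξ.k) i)) - (b i : ℤ) • pr none

/-- The indices of the inequalities of the characteristic system: positivity of the multiplicities,
first laps and last laps. -/
abbrev IneqIdx : Type :=
  (Σ j, (ξ.comp j).Trans) ⊕
    Σ j, Fin D × Fin ((ξ.comp j).numTrans + 1) × Option (ξ.comp j).Trans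

/-- The homogenized inequalities. -/
noncomputable def ineq : ξ.IneqIdx → (Option ξ.Var → ℤ) →ₗ[ℤ] ℤ
  | .inl u => pr (some (Var.psi u.1 u.2)) - pr none
  | .inr ⟨j, i, n, none⟩ => pr (some (Var.x j i)) +
      (ξ.comp j).disp ((ξ.comp j).lap.take n) i • pr none
  | .inr ⟨j, i, n, some e⟩ => pr (some (Var.x j i)) +
      (ξ.comp j).disp (ξ.comp j).lap i • (pr (some (Var.psi j e)) - pr none) +
      (ξ.comp j).disp ((ξ.comp j).lap.take n) i • pr none

variable {ξ} {a b : Fin D → ℕ}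

theorem dispParikh_apply {G : VASS D} (ψ : G.Trans → ℕ) (i : Fin D) :
    G.dispParikh ψ i = ∑ e, (ψ e : ℤ) * G.label e i := by
  simp [dispParikh, Finset.sum_apply]

/-- Setting the homogenizing variable to $0$ deletes the constants, so the functionals of $\mathcal
E$ also describe $\mathcal E^0$, for any choice of `a` and `b`. -/
theorem isHomSolution_iff {m : ξ.Assignment} : ξ.IsHomSolution m ↔
    m ≠ 0 ∧ ∀ r, ξ.eqn a b r (homVec (fun v => ξ.coords m v) 0) = 0 := by
  constructor
  · intro h
    refine ⟨h.ne_zero, ?_⟩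
    rintro (⟨j, s⟩ | ⟨j, i⟩ | ⟨j, i⟩ | i | i)
    · have := congrFun (h.euler j) s
      simpa [eqn, homVec, mul_comm] using this
    · have := congrFun (h.disp j) i
      simp only [Pi.add_apply, dispParikh_apply, toInt] at this
      simp [eqn, homVec, mul_comm, this]
    · have := congrFun (h.conn j) i
      simp [eqn, homVec, this]
    · have := congrFun h.start i
      simp [eqn, homVec, this]
    · have := congrFun h.finish i
      simp [eqn, homVec, this]
  · rintro ⟨h0, h⟩
    refine ⟨h0, fun j => ?_, fun j => ?_, fun j => ?_, ?_, ?_⟩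
    · ext s
      simpa [eqn, homVec, mul_comm] using h (.euler j s)
    · ext i
      simp only [Pi.add_apply, dispParikh_apply, toInt]
      simpa [eqn, homVec, mul_comm, sub_eq_zero] using h (.disp j i)
    · ext i
      have := h (.conn j i)
      simp [eqn, homVec, sub_eq_zero] at this
      exact_mod_cast this
    · ext i
      simpa [eqn, homVec] using h (.start i)
    · ext i
      simpa [eqn, homVec] using h (.finish i)

theorem isSolution_iff {m : ξ.Assignment} : ξ.IsSolution a b m ↔
    (∀ r, ξ.eqn a b r (homVec (fun v => ξ.coords m v) 1) = 0) ∧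
      ∀ u, 0 ≤ ξ.ineq u (homVec (fun v => ξ.coords m v) 1) := by
  constructor
  · intro h
    constructor
    · rintro (⟨j, s⟩ | ⟨j, i⟩ | ⟨j, i⟩ | i | i)
      · have := congrFun (h.euler j) s
        simpa [eqn, homVec, mul_comm, sub_eq_zero] using this
      · have := congrFun (h.disp j) i
        simp only [Pi.add_apply, dispParikh_apply, toInt] at this
        simp [eqn, homVec, mul_comm, this]
      · have := congrFun (h.conn j) i
        simp only [Pi.add_apply, toInt] at this
        simp [eqn, homVec, this]
      · have := congrFun h.start i
        simp [eqn, homVec, this]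
      · have := congrFun h.finish i
        simp [eqn, homVec, this]
    · rintro (⟨j, e⟩ | ⟨j, i, n, _ | e⟩)
      · have := h.pos j e
        simp [ineq, homVec]
        omega
      · by_cases hl : (ξ.comp j).IsLinear
        · have := h.firstLap j hl _ hl.isLap_lap n
            (by rw [hl.isLap_lap.length_eq]; omega) i trivial
          simpa [ineq, homVec, toInt] using this
        -- For a nonlinear component the default lap is empty, and the inequality degenerates to
        -- $\mathbf x_j(i)\ge0$.
        · simp [ineq, homVec, ConstraintGraph.lap, hl]
      · by_cases hl : (ξ.comp j).IsLinear
        · have := h.lastLap j hl _ hl.isLap_lap e n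
            (by rw [hl.isLap_lap.length_eq]; omega) i trivial
          simpa [ineq, homVec, toInt, mul_comm] using this
        · simp [ineq, homVec, ConstraintGraph.lap, hl]
  · rintro ⟨h, h'⟩
    refine ⟨fun j => ?_, fun j e => ?_, fun j => ?_, fun j => ?_, ?_, ?_, fun j hl π hπ => ?_,
      fun j hl π hπ e => ?_⟩
    · ext s
      simpa [eqn, homVec, mul_comm, sub_eq_zero] using h (.euler j s)
    · have := h' (.inl ⟨j, e⟩)
      simp [ineq, homVec] at this
      omega
    · ext i
      simp only [Pi.add_apply, dispParikh_apply, toInt]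
      simpa [eqn, homVec, mul_comm, sub_eq_zero] using h (.disp j i)
    · ext i
      have := h (.conn j i)
      simpa [eqn, homVec, toInt, sub_eq_zero] using this
    · ext i
      have := h (.start i)
      simp [eqn, homVec, sub_eq_zero] at this
      exact_mod_cast this
    · ext i
      have := h (.finish i)
      simp [eqn, homVec, sub_eq_zero] at this
      exact_mod_cast this
    · obtain rfl := hl.eq_lap hπ
      intro n hn i _
      have := h' (.inr ⟨j, i, ⟨n, by rw [hπ.length_eq] at hn; omega⟩, none⟩)
      simpa [ineq, homVec, toInt] using this
    · obtain rfl := hl.eq_lap hπ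
      intro n hn i _
      have := h' (.inr ⟨j, i, ⟨n, by rw [hπ.length_eq] at hn; omega⟩, some e⟩)
      simpa [ineq, homVec, toInt, mul_comm] using this

end CGS

/-! ### Bounds for the solutions of the characteristic systems -/

namespace CGS

variable {D : ℕ} (ξ : CGS D) (a b : Fin D → ℕ)

open VASS

theorem abs_mul_le_of_abs_le_one {c z C : ℤ} (hc : |c| ≤ C) (hz : |z| ≤ 1) : |c * z| ≤ C := by
  rw [abs_mul]
  nlinarith [abs_nonneg c, abs_nonneg z]

theorem abs_sum_mul_le {n : ℕ} {c f : Fin n → ℤ} {C : ℤ} (hc : ∀ e, |c e| ≤ C)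
    (hf : ∀ e, |f e| ≤ 1) : |∑ e, c e * f e| ≤ n * C := by
  refine (Finset.abs_sum_le_sum_abs _ _).trans ?_
  refine (Finset.sum_le_sum fun e _ => abs_mul_le_of_abs_le_one (hc e) (hf e)).trans ?_
  simp

theorem abs_single_sub_single_le {n : ℕ} (p q s : Fin n) :
    |(Pi.single p 1 : Fin n → ℤ) s - (Pi.single q 1 : Fin n → ℤ) s| ≤ 1 := by
  simp only [Pi.single_apply]
  split_ifs <;> simp

/-- A bound on the coefficients of the characteristic system. -/
abbrev coeffBound : ℕ := 2 + 3 * (ξ.instSize a b * 2 ^ ξ.instSize a b)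

theorem eqn_isBddBy (r : ξ.Row) : IsBddBy (ξ.eqn a b r) (ξ.coeffBound a b) := by
  intro f hf
  set S := ξ.instSize a b with hS
  have h2 : 2 ≤ S := ξ.two_le_instSize a b
  have hA : (1 : ℤ) ≤ (2 ^ S : ℕ) := by exact_mod_cast Nat.one_le_two_pow
  have hSA : (2 : ℤ) * (2 ^ S : ℕ) ≤ S * (2 ^ S : ℕ) := by
    have : (2 : ℤ) ≤ S := by exact_mod_cast h2
    nlinarith
  have hSS : (S : ℤ) ≤ S * (2 ^ S : ℕ) := by nlinarith
  have hcast : ((ξ.coeffBound a b : ℕ) : ℤ) = 2 + 3 * (S * (2 ^ S : ℕ)) := by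
    rw [coeffBound]; push_cast; rfl
  rw [hcast]
  rcases r with ⟨j, s⟩ | ⟨j, i⟩ | ⟨j, i⟩ | i | i
  · have h₁ := abs_sum_mul_le (f := fun e => f (some (Var.psi j e)))
      (fun e => abs_single_sub_single_le ((ξ.comp j).tgt e) ((ξ.comp j).src e) s) fun e => hf _
    have h₂ := abs_mul_le_of_abs_le_one
      (abs_single_sub_single_le (ξ.comp j).exit (ξ.comp j).entry s) (hf none)
    have h₃ : ((ξ.comp j).numTrans : ℤ) ≤ S := by exact_mod_cast ξ.numTrans_le a b j
    simp only [eqn, LinearMap.sub_apply, LinearMap.sum_apply, LinearMap.smul_apply,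
      LinearMap.proj_apply, smul_eq_mul]
    refine (abs_sub _ _).trans ?_
    linarith
  · have h₁ := abs_sum_mul_le (f := fun e => f (some (Var.psi j e)))
      (fun e => ξ.abs_label_le a b j e i) fun e => hf _
    have h₃ : ((ξ.comp j).numTrans : ℤ) ≤ S := by exact_mod_cast ξ.numTrans_le a b j
    have h₄ : ((ξ.comp j).numTrans : ℤ) * (2 ^ S : ℕ) ≤ S * (2 ^ S : ℕ) := by gcongr
    have h₅ := hf (some (Var.x j i))
    have h₆ := hf (some (Var.y j i))
    simp only [eqn, LinearMap.sub_apply, LinearMap.add_apply, LinearMap.sum_apply,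
      LinearMap.smul_apply, LinearMap.proj_apply, smul_eq_mul]
    refine (abs_sub _ _).trans ((add_le_add_left (abs_add_le _ _) _).trans ?_)
    linarith
  · have h₁ := abs_mul_le_of_abs_le_one (ξ.abs_conn_le a b j i) (hf none)
    have h₅ := hf (some (Var.x j.succ i))
    have h₆ := hf (some (Var.y j.castSucc i))
    simp only [eqn, LinearMap.sub_apply, LinearMap.add_apply,
      LinearMap.smul_apply, LinearMap.proj_apply, smul_eq_mul]
    refine (abs_sub _ _).trans ((add_le_add_left (abs_add_le _ _) _).trans ?_)
    linarith
  · have h₁ : |(a i : ℤ)| ≤ (2 ^ S : ℕ) := by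
      rw [Nat.abs_cast]; exact_mod_cast ξ.start_le a b i
    have h₂ := abs_mul_le_of_abs_le_one h₁ (hf none)
    have h₅ := hf (some (Var.x 0 i))
    simp only [eqn, LinearMap.sub_apply, LinearMap.smul_apply, LinearMap.proj_apply, smul_eq_mul]
    refine (abs_sub _ _).trans ?_
    linarith
  · have h₁ : |(b i : ℤ)| ≤ (2 ^ S : ℕ) := by
      rw [Nat.abs_cast]; exact_mod_cast ξ.finish_le a b i
    have h₂ := abs_mul_le_of_abs_le_one h₁ (hf none)
    have h₅ := hf (some (Var.y (Fin.last ξ.k) i))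
    simp only [eqn, LinearMap.sub_apply, LinearMap.smul_apply, LinearMap.proj_apply, smul_eq_mul]
    refine (abs_sub _ _).trans ?_
    linarith

theorem ineq_isBddBy (u : ξ.IneqIdx) : IsBddBy (ξ.ineq u) (ξ.coeffBound a b) := by
  intro f hf
  set S := ξ.instSize a b with hS
  have h2 : 2 ≤ S := ξ.two_le_instSize a b
  have hA : (1 : ℤ) ≤ (2 ^ S : ℕ) := by exact_mod_cast Nat.one_le_two_pow
  have hSA : (0 : ℤ) ≤ S * (2 ^ S : ℕ) := by positivity
  have hcast : ((ξ.coeffBound a b : ℕ) : ℤ) = 2 + 3 * (S * (2 ^ S : ℕ)) := by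
    rw [coeffBound]; push_cast; rfl
  rw [hcast]
  have hdisp : ∀ j i (n : ℕ), |(ξ.comp j).disp ((ξ.comp j).lap.take n) i| ≤ S * (2 ^ S : ℕ) := by
    intro j i n
    refine (abs_disp_le (ξ.abs_label_le a b j) _ i).trans ?_
    have h₁ : ((ξ.comp j).lap.take n).length ≤ S := by
      have := (ξ.comp j).length_lap_le
      have := ξ.numTrans_le a b j
      simp only [List.length_take]
      omega
    have h₂ : (((ξ.comp j).lap.take n).length : ℤ) ≤ S := by exact_mod_cast h₁
    nlinarith
  rcases u with ⟨j, e⟩ | ⟨j, i, n, _ | e⟩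
  · have h₁ := hf (some (Var.psi j e))
    have h₂ := hf none
    simp only [ineq, LinearMap.sub_apply, LinearMap.proj_apply]
    refine (abs_sub _ _).trans ?_
    linarith
  · have h₁ := hf (some (Var.x j i))
    have h₂ := abs_mul_le_of_abs_le_one (hdisp j i n) (hf none)
    simp only [ineq, LinearMap.add_apply, LinearMap.smul_apply, LinearMap.proj_apply, smul_eq_mul]
    refine (abs_add_le _ _).trans ?_
    linarith
  · have h₁ := hf (some (Var.x j i))
    have h₂ := abs_mul_le_of_abs_le_one (hdisp j i n) (hf none)
    have h₃ : |(ξ.comp j).disp (ξ.comp j).lap i| ≤ S * (2 ^ S : ℕ) := by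
      simpa using hdisp j i (ξ.comp j).lap.length
    have h₄ := abs_mul_le_of_abs_le_one h₃ (hf none)
    have h₅ := abs_mul_le_of_abs_le_one h₃ (hf (some (Var.psi j e)))
    simp only [ineq, LinearMap.add_apply, LinearMap.sub_apply, LinearMap.smul_apply,
      LinearMap.proj_apply, smul_eq_mul, mul_sub]
    refine (abs_add_le _ _).trans ((add_le_add_left ((abs_add_le _ _).trans
      (add_le_add_right (abs_sub _ _) _)) _).trans ?_)
    linarith

theorem card_le : Fintype.card (Option ξ.Var ⊕ ξ.IneqIdx) ≤ ξ.instSize a b ^ 7 := by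
  set S := ξ.instSize a b with hS
  have h2 : 2 ≤ S := ξ.two_le_instSize a b
  have hk : ξ.k + 1 ≤ S := ξ.k_lt_instSize a b
  have hD : D ≤ S := ξ.dim_le_instSize a b
  have hT : ∑ j, (ξ.comp j).numTrans ≤ S := ξ.sum_numTrans_le a b
  have hkD : (ξ.k + 1) * D ≤ S * S := Nat.mul_le_mul hk hD
  have hsum : ∑ j, D * (((ξ.comp j).numTrans + 1) * ((ξ.comp j).numTrans + 1)) ≤
      S * (S * ((S + 1) * (S + 1))) := by
    refine (Finset.sum_le_card_nsmul _ _ (S * ((S + 1) * (S + 1))) fun j _ => ?_).trans ?_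
    · have := ξ.numTrans_le a b j
      gcongr
    · simp only [Finset.card_univ, Fintype.card_fin, smul_eq_mul]
      gcongr
  have hS1 : S + 1 ≤ S * S := by nlinarith
  have hsum' : S * (S * ((S + 1) * (S + 1))) ≤ S ^ 6 := by
    calc S * (S * ((S + 1) * (S + 1))) ≤ S * (S * ((S * S) * (S * S))) := by gcongr
      _ = S ^ 6 := by ring
  simp only [Fintype.card_sum, Fintype.card_option, Fintype.card_prod, Fintype.card_sigma,
    Fintype.card_fin]
  have h3 : 2 * (S * S) + 2 * S + 1 ≤ S ^ 6 := by
    have h4 : 2 * (S * S) ≤ S ^ 3 := by nlinarith [Nat.zero_le (S * S)]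
    have h5 : 2 * S + 1 ≤ S ^ 3 := by nlinarith
    have h6 : S ^ 3 * 2 ≤ S ^ 3 * S := Nat.mul_le_mul_left _ h2
    have h7 : S ^ 4 ≤ S ^ 6 := Nat.pow_le_pow_right (by omega) (by norm_num)
    have : S ^ 3 * S = S ^ 4 := by ring
    omega
  have h8 : S ^ 6 * 2 ≤ S ^ 6 * S := Nat.mul_le_mul_left _ h2
  have : S ^ 6 * S = S ^ 7 := by ring
  omega

theorem coeffBound_le : ξ.coeffBound a b ≤ 2 ^ ξ.instSize a b ^ 7 := by
  set S := ξ.instSize a b with hS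
  have h2 : 2 ≤ S := ξ.two_le_instSize a b
  have hA : 2 ^ S ≤ 2 ^ S ^ 1 := by simp
  have hSA : S * 2 ^ S ≤ 2 ^ S ^ 2 := exp_mul h2 (le_exp (by simp)) hA
  have h3 : 3 ≤ 2 ^ S ^ 2 := (show 3 ≤ 2 ^ 2 ^ 2 by norm_num).trans
    (Nat.pow_le_pow_right (by norm_num) (Nat.pow_le_pow_left h2 2))
  exact exp_mono h2 (exp_add h2 (two_le_exp h2 3) (exp_mul h2 h3 hSA)) (by norm_num)

theorem one_le_coeffBound : 1 ≤ ξ.coeffBound a b := by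
  rw [coeffBound]; omega

/-- The product $Nc$ is at exponent $8$, its $N$-th power at $15$, and the outer factor $N$ leads to
$16$. -/
theorem diophantine_bound_le {S N c : ℕ} (hS : 2 ≤ S) (hN : N ≤ S ^ 7) (hc : c ≤ 2 ^ S ^ 7) :
    N * (N * c) ^ N ≤ 2 ^ S ^ 16 := by
  have h₁ : N * c ≤ 2 ^ S ^ 8 := exp_mul hS (le_exp hN) hc
  exact exp_mul hS (exp_mono hS (le_exp hN) (by norm_num)) (exp_pow h₁ hN)

theorem minSolutions_le {m : ξ.Assignment} (hm : m ∈ ξ.minSolutions a b) (v : ξ.Var) :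
    ξ.coords m v ≤ 2 ^ ξ.instSize a b ^ 16 := by
  obtain ⟨h₁, h₂⟩ := isSolution_iff.1 hm.1
  refine (minimal_inhomogeneous_le (ξ.one_le_coeffBound a b) (ξ.eqn_isBddBy a b)
    (ξ.ineq_isBddBy a b) h₁ h₂ (fun y hy hL hK => ?_) v).trans
    (diophantine_bound_le (ξ.two_le_instSize a b) (ξ.card_le a b) (ξ.coeffBound_le a b))
  obtain ⟨m', rfl⟩ := ξ.coords.surjective y
  have hle : m' ≤ m := ξ.coords.le_iff_le.1 hy
  rw [le_antisymm hle (hm.2 (isSolution_iff.2 ⟨hL, hK⟩) hle)]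

theorem card_var_le : Fintype.card ξ.Var ≤ ξ.instSize a b ^ 7 := by
  have h := ξ.card_le a b
  simp only [Fintype.card_sum (α := Option ξ.Var), Fintype.card_option] at h
  omega

theorem homBase_le {m : ξ.Assignment} (hm : m ∈ ξ.homBase) (v : ξ.Var) :
    ξ.coords m v ≤ 2 ^ ξ.instSize a b ^ 16 := by
  classical
  obtain ⟨h₀, h₁⟩ := (isHomSolution_iff (a := a) (b := b)).1 hm.1
  let ext0 : (ξ.Var → ℤ) →ₗ[ℤ] (Option ξ.Var → ℤ) :=
    { toFun := fun x => homVec x 0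
      map_add' := fun x y => by ext o; cases o <;> rfl
      map_smul' := fun c y => by ext o; cases o <;> simp [homVec] }
  refine (minimal_homogeneous_le (L := fun r => (ξ.eqn a b r).comp ext0)
    (ξ.one_le_coeffBound a b) (fun r f hf => ξ.eqn_isBddBy a b r _ fun o => ?_) h₁
    (fun y hy0 hy hL => ?_) v).trans
    (diophantine_bound_le (ξ.two_le_instSize a b) (ξ.card_var_le a b) (ξ.coeffBound_le a b))
  · rcases o with _ | u
    · simp [ext0, homVec]
    · exact hf u
  · obtain ⟨m', rfl⟩ := ξ.coords.surjective y
    have hle : m' ≤ m := ξ.coords.le_iff_le.1 hy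
    have hne : m' ≠ 0 := by
      rintro rfl
      exact hy0 (by ext (u | u | u) <;> rfl)
    rw [le_antisymm hle (hm.2 ((isHomSolution_iff (a := a) (b := b)).2 ⟨hne, hL⟩) hle)]

theorem coords_sum (s : Finset ξ.Assignment) (v : ξ.Var) :
    ξ.coords (∑ m ∈ s, m) v = ∑ m ∈ s, ξ.coords m v := by
  classical
  induction s using Finset.induction_on with
  | empty => rcases v with (v | v | v) <;> rfl
  | insert m s hm ih =>
    rw [Finset.sum_insert hm, Finset.sum_insert hm, ← ih]
    rcases v with (v | v | v) <;> rfl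

theorem homSum_le (v : ξ.Var) : ξ.coords ξ.homSum v ≤ 2 ^ ξ.instSize a b ^ 25 := by
  classical
  set S := ξ.instSize a b with hS
  have h2 : 2 ≤ S := ξ.two_le_instSize a b
  set B := 2 ^ S ^ 16 with hB
  -- The minimal homogeneous solutions are functions on the variables with values in
  -- $\{0,\dots,B\}$. Counting these gives exponent $24$, and summing values of size at most $B$
  -- gives $25$.
  have hcard : ξ.homBase_finite.toFinset.card ≤ (B + 1) ^ Fintype.card ξ.Var := by
    have hinj : Set.InjOn (fun m : ξ.Assignment => ξ.coords m) ξ.homBase_finite.toFinset :=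
      ξ.coords.injective.injOn
    have := Finset.card_le_card_of_injOn (t := Fintype.piFinset fun _ : ξ.Var => Finset.range (B + 1))
      (fun m : ξ.Assignment => ξ.coords m) (fun m hm => by
        have hm' : m ∈ ξ.homBase := by simpa using hm
        simp only [Finset.mem_coe, Fintype.mem_piFinset, Finset.mem_range]
        exact fun v => Nat.lt_succ_of_le (ξ.homBase_le a b hm' v)) hinj
    simpa using this
  have h₁ : (B + 1) ^ Fintype.card ξ.Var ≤ 2 ^ S ^ 24 :=
    exp_pow (exp_add (a := 16) h2 le_rfl (by exact (two_le_exp h2 16).trans' (by norm_num)))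
      (ξ.card_var_le a b)
  rw [homSum, coords_sum]
  refine (Finset.sum_le_card_nsmul _ _ B fun m hm => ξ.homBase_le a b (by simpa using hm) v).trans ?_
  exact exp_mul h2 (hcard.trans h₁) (exp_mono h2 le_rfl (by norm_num))

end CGS

/-! ### Pumping an unbounded component -/

namespace VASS

variable {D : ℕ} {G : VASS D}

theorem parikh_power (π : List G.Trans) (c : ℕ) : parikh (power π c) = c • parikh π := by
  induction c with
  | zero => simp
  | succ c ih => rw [power_succ, parikh_append, ih, succ_nsmul, add_comm]

theorem staysNonneg_of_rev {I : Set (Fin D)} {r : Fin D → ℤ} {π : List G.Trans}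
    (h : G.rev.StaysNonneg I (r + G.disp π) π.reverse) : G.StaysNonneg I r π := by
  rw [staysNonneg_iff] at h
  refine staysNonneg_iff.2 ?_
  rintro σ τ rfl i hi
  have := h τ.reverse σ.reverse List.reverse_append i hi
  rw [disp_rev] at this
  simp only [disp_append, Pi.add_apply, Pi.neg_apply] at *
  linarith

/-- A pumped path stays nonnegative in an entry with positive effects of one round of pumping. -/
theorem staysNonneg_pumped {A : ℕ} (hA : ∀ e i, |G.label e i| ≤ A) {i : Fin D}
    {x y x₀ y₀ : Fin D → ℕ} {u v w π : List G.Trans} {R c : ℕ}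
    (hus : ¬ 0 < x₀ i → G.StaysNonneg {i} (toInt x) u) (hup : ¬ 0 < x₀ i → 1 ≤ G.disp u i)
    (hvs : ¬ 0 < y₀ i → G.StaysNonneg {i} (toInt y - G.disp v) v)
    (hvp : ¬ 0 < y₀ i → G.disp v i ≤ -1)
    (hdw : G.disp w i + (G.disp u i + G.disp v i) = R * ((y₀ i : ℤ) - x₀ i))
    (hdπ : (x i : ℤ) + G.disp π i = y i)
    (hR : (A : ℤ) * u.length + A * v.length + 1 ≤ R) (hcw : (A : ℤ) * w.length ≤ c)
    (hcv : (A : ℤ) * v.length ≤ c) (hcπ : (A : ℤ) * π.length ≤ c) (hc1 : (1 : ℤ) ≤ c)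
    {X : Fin D → ℤ} (hX : X i = (x i : ℤ) + c * (R * x₀ i)) :
    G.StaysNonneg {i} X (power u c ++ (power w c ++ (π ++ power v c))) := by
  have single : ∀ {P : Fin D → Prop}, P i → ∀ k ∈ ({i} : Set (Fin D)), P k := by
    rintro P h k rfl
    exact h
  have hAu := abs_le.1 (abs_disp_le hA u i)
  have hAv := abs_le.1 (abs_disp_le hA v i)
  have hA0 : (0 : ℤ) ≤ A * u.length := by positivity
  have hA0' : (0 : ℤ) ≤ A * v.length := by positivity
  have hRpos : (0 : ℤ) ≤ R := by positivity
  have hRx : 0 < x₀ i → (R : ℤ) ≤ R * x₀ i := fun h =>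
    le_mul_of_one_le_right hRpos (by exact_mod_cast h)
  have hRy : 0 < y₀ i → (R : ℤ) ≤ R * y₀ i := fun h =>
    le_mul_of_one_le_right hRpos (by exact_mod_cast h)
  -- Per round, $\alpha$ is the starting surplus $R\,x_0(i)$ plus the effect of `u`. If $x_0(i)>0$,
  -- the size of `R` makes it positive; otherwise pumping does. The quantity $\beta$ plays the same
  -- role at the exit.
  have hα : 1 ≤ (R : ℤ) * x₀ i + G.disp u i := by
    by_cases h : 0 < x₀ i
    · linarith [hRx h]
    · have := hup h
      have hx0 : x₀ i = 0 := by omega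
      simpa [hx0] using this
  have hβ : 1 ≤ (R : ℤ) * y₀ i - G.disp v i := by
    by_cases h : 0 < y₀ i
    · linarith [hRy h]
    · have := hvp h
      have hy0 : y₀ i = 0 := by omega
      rw [hy0]
      push_cast
      linarith
  set α : ℤ := (R : ℤ) * x₀ i + G.disp u i with hαdef
  set β : ℤ := (R : ℤ) * y₀ i - G.disp v i with hβdef
  have hcα : (c : ℤ) ≤ c * α := le_mul_of_one_le_right (by linarith) hα
  have hcβ : (c : ℤ) ≤ c * β := le_mul_of_one_le_right (by linarith) hβ
  have hx0' : (0 : ℤ) ≤ x i := by positivity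
  have hy0' : (0 : ℤ) ≤ y i := by positivity
  have hXu : (x i : ℤ) + c * (R * x₀ i) + c * G.disp u i = x i + c * α := by rw [hαdef]; ring
  -- As `w` has displacement $\beta-\alpha$, the block $w^c$ leads from $x+c\alpha$ to $x+c\beta$.
  -- Both are at least $c$, which exceeds every possible loss within one copy of `w`.
  have hXw : (x i : ℤ) + c * α + c * G.disp w i = x i + c * β := by
    have : G.disp w i = β - α := by rw [hαdef, hβdef]; linarith
    rw [this]; ring
  simp only [staysNonneg_append]
  refine ⟨staysNonneg_power ?_ ?_, staysNonneg_power ?_ ?_, ?_, staysNonneg_power ?_ ?_⟩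
  · by_cases h : 0 < x₀ i
    · refine staysNonneg_of_large hA ?_
      refine single ?_
      rw [hX]
      have : (R : ℤ) * x₀ i ≤ c * (R * x₀ i) := le_mul_of_one_le_left (by positivity) hc1
      linarith [hRx h]
    · refine staysNonneg_of_le (hus h) ?_
      · refine single ?_
        rw [hX]
        have : (0 : ℤ) ≤ c * (R * x₀ i) := by positivity
        simp only [toInt]
        linarith
  · by_cases h : 0 < x₀ i
    · refine staysNonneg_of_large hA ?_
      refine single ?_
      simp only [Pi.add_apply, Pi.smul_apply, smul_eq_mul, hX]
      have h₁ : (0 : ℤ) ≤ (c - 1) * α := mul_nonneg (by linarith) (by linarith)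
      have h₂ := hRx h
      have h₃ : (x i : ℤ) + c * (R * x₀ i) + (c - 1) * G.disp u i =
          x i + (c - 1) * α + R * x₀ i := by rw [hαdef]; ring
      linarith
    · refine staysNonneg_of_le (hus h) ?_
      · refine single ?_
        have hd := hup h
        simp only [Pi.add_apply, Pi.smul_apply, smul_eq_mul, hX]
        have : (0 : ℤ) ≤ c * (R * x₀ i) := by positivity
        have : (0 : ℤ) ≤ (c - 1) * G.disp u i := mul_nonneg (by linarith) (by linarith)
        simp only [toInt]
        linarith
  · refine staysNonneg_of_large hA ?_
    refine single ?_
    simp only [disp_power, Pi.add_apply, Pi.smul_apply, smul_eq_mul, hX]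
    linarith
  · refine staysNonneg_of_large_end hA ?_
    refine single ?_
    simp only [disp_power, Pi.add_apply, Pi.smul_apply, smul_eq_mul, hX]
    linarith
  · refine staysNonneg_of_large hA ?_
    refine single ?_
    simp only [disp_power, Pi.add_apply, Pi.smul_apply, smul_eq_mul, hX]
    linarith
  · by_cases h : 0 < y₀ i
    · refine staysNonneg_of_large hA ?_
      refine single ?_
      simp only [disp_power, Pi.add_apply, Pi.smul_apply, smul_eq_mul, hX]
      linarith
    · refine staysNonneg_of_le (hvs h) ?_
      · refine single ?_
        have hy0 : y₀ i = 0 := by omega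
        have hd := hvp h
        have hβ' : β = - G.disp v i := by simp [hβdef, hy0]
        have : β ≤ c * β := le_mul_of_one_le_left (by linarith) hc1
        simp only [disp_power, Pi.add_apply, Pi.sub_apply, Pi.smul_apply, smul_eq_mul, hX, toInt]
        linarith
  · by_cases h : 0 < y₀ i
    · refine staysNonneg_of_large_end hA ?_
      refine single ?_
      have h₂ : (R : ℤ) ≤ c * (R * y₀ i) :=
        (hRy h).trans (le_mul_of_one_le_left (by positivity) hc1)
      have h₃ : (c : ℤ) * β + c * G.disp v i = c * (R * y₀ i) := by rw [hβdef]; ring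
      simp only [disp_power, Pi.add_apply, Pi.smul_apply, smul_eq_mul, hX]
      linarith
    · refine staysNonneg_of_le (hvs h) ?_
      · refine single ?_
        have hy0 : y₀ i = 0 := by omega
        have hβ' : β = - G.disp v i := by simp [hβdef, hy0]
        have h₃ : (c : ℤ) * β + (c - 1) * G.disp v i = - G.disp v i := by rw [hβ']; ring
        simp only [disp_power, Pi.add_apply, Pi.sub_apply, Pi.smul_apply, smul_eq_mul, hX, toInt]
        linarith

/-- Pumping: a component with a positive circulation and with pumping cycles at the entry and at the
exit admits a walk whose Parikh image is a solution plus a multiple of the circulation. -/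
theorem StronglyConnected.exists_pumped_walk (hG : G.StronglyConnected) {A : ℕ}
    (hA : ∀ e i, |G.label e i| ≤ A) {p q : G.State} {x y x₀ y₀ : Fin D → ℕ} {ψ ψ₀ : G.Trans → ℕ}
    (hψ : G.bdry ψ = Pi.single q 1 - Pi.single p 1) (hψpos : ∀ e, 0 < ψ e)
    (hxy : toInt x + G.dispParikh ψ = toInt y)
    (hψ₀ : G.bdry ψ₀ = 0) (hψ₀pos : ∀ e, 0 < ψ₀ e)
    (hxy₀ : toInt x₀ + G.dispParikh ψ₀ = toInt y₀)
    {u v : List G.Trans} (hu : G.IsPath p u p) (hv : G.IsPath q v q)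
    (hus : G.StaysNonneg {i | ¬ 0 < x₀ i ∧ ¬ G.Orthogonal i} (toInt x) u)
    (hup : ∀ i, ¬ 0 < x₀ i ∧ ¬ G.Orthogonal i → 1 ≤ G.disp u i)
    (hvs : G.StaysNonneg {i | ¬ 0 < y₀ i ∧ ¬ G.Orthogonal i} (toInt y - G.disp v) v)
    (hvp : ∀ i, ¬ 0 < y₀ i ∧ ¬ G.Orthogonal i → G.disp v i ≤ -1)
    (horth : ∀ i, G.Orthogonal i → ¬ 0 < x₀ i → ∀ (o : G.State) (π : List G.Trans),
      G.IsPath p π o → 0 ≤ (toInt x + G.disp π) i)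
    {R c : ℕ} (hR : (A + 1) * (u.length + v.length) + 1 ≤ R)
    (hc : A * (R * ∑ e, ψ₀ e) + A * ∑ e, ψ e + 1 ≤ c) :
    ∃ π, G.IsPath p π q ∧ parikh π = ψ + (c * R) • ψ₀ ∧
      G.StaysNonneg Set.univ (toInt (x + (c * R) • x₀)) π := by
  -- Strictness makes the remainder positive on every edge, as Euler's theorem requires.
  have hcount : ∀ e, parikh u e + parikh v e < R * ψ₀ e := fun e => by
    have h₁ : parikh u e ≤ u.length := List.count_le_length
    have h₂ : parikh v e ≤ v.length := List.count_le_length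
    have h₃ : R ≤ R * ψ₀ e := Nat.le_mul_of_pos_right _ (hψ₀pos e)
    nlinarith [Nat.zero_le (A * (u.length + v.length))]
  have hsplit : (R • ψ₀ - (parikh u + parikh v)) + (parikh u + parikh v) = R • ψ₀ :=
    tsub_add_cancel_of_le fun e => (hcount e).le
  obtain ⟨w, hw, hwψ⟩ := hG.exists_eulerian_path (ψ := R • ψ₀ - (parikh u + parikh v)) (p := p)
    (q := p) (fun e => by simpa using hcount e) (by
      have := congrArg G.bdry hsplit
      rw [bdry_add, bdry_add, hu.bdry_parikh, hv.bdry_parikh, bdry_smul, hψ₀] at this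
      simpa using this)
  obtain ⟨π, hπ, hπψ⟩ := hG.exists_eulerian_path hψpos hψ
  rw [← hwψ] at hsplit
  have hlen : w.length + (u.length + v.length) = R * ∑ e, ψ₀ e := by
    simp only [length_eq_sum_parikh, ← Finset.sum_add_distrib, Finset.mul_sum]
    exact Finset.sum_congr rfl fun e _ => congrFun hsplit e
  have hlenπ : π.length = ∑ e, ψ e := by rw [length_eq_sum_parikh, hπψ]
  refine ⟨power u c ++ (power w c ++ (π ++ power v c)),
    (hu.power c).append ((hw.power c).append (hπ.append (hv.power c))), ?_, ?_⟩
  · simp only [parikh_append, parikh_power, hπψ]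
    rw [mul_smul, ← hsplit]
    simp only [smul_add]
    abel
  rw [staysNonneg_univ_iff]
  intro i
  -- Here pumping is of no help, but such an entry is nonnegative along every path from `p`.
  by_cases hi : G.Orthogonal i ∧ ¬ 0 < x₀ i
  · rw [staysNonneg_iff]
    intro σ τ hσ k hk
    rw [Set.mem_singleton_iff.1 hk]
    have hfull := (hu.power c).append ((hw.power c).append (hπ.append (hv.power c)))
    rw [hσ] at hfull
    obtain ⟨o, ho, -⟩ := isPath_append.1 hfull
    have := horth _ hi.1 hi.2 o σ ho
    have hx0 : x₀ i = 0 := by omega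
    simpa [toInt, hx0] using this
  have hdw : G.disp w i + (G.disp u i + G.disp v i) = R * ((y₀ i : ℤ) - x₀ i) := by
    have h₁ := congrFun (congrArg G.dispParikh hsplit) i
    have h₂ := congrFun hxy₀ i
    simp only [dispParikh_add, dispParikh_parikh, dispParikh_smul, Pi.add_apply, Pi.smul_apply,
      smul_eq_mul, toInt] at h₁ h₂
    rw [h₁, ← h₂]
    ring
  have hdπ : (x i : ℤ) + G.disp π i = y i := by
    have := congrFun hxy i
    rwa [← hπψ, dispParikh_parikh] at this
  have hR' : (A : ℤ) * u.length + A * v.length + 1 ≤ R := by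
    have : A * u.length + A * v.length + 1 ≤ R := by nlinarith
    exact_mod_cast this
  have hcw : (A : ℤ) * w.length ≤ c ∧ (A : ℤ) * v.length ≤ c ∧ (A : ℤ) * π.length ≤ c ∧
      (1 : ℤ) ≤ c := by
    rw [← hlen, ← hlenπ] at hc
    refine ⟨?_, ?_, ?_, ?_⟩ <;> norm_cast <;>
      nlinarith [Nat.zero_le (A * w.length), Nat.zero_le (A * u.length), Nat.zero_le (A * v.length),
        Nat.zero_le (A * π.length)]
  obtain ⟨hcw, hcv, hcπ, hc1⟩ := hcw
  -- An Eulerian circuit for `ψ₀` has displacement zero in an orthogonal entry, so there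
  -- $x_0(i)=y_0(i)$. With the previous case excluded, an entry bounded at the exit cannot be
  -- orthogonal.
  have horth' : ¬ 0 < y₀ i → ¬ G.Orthogonal i := by
    intro h hO
    obtain ⟨ρ, hρ, hρψ⟩ := hG.exists_eulerian_path hψ₀pos (p := p) (q := p) (by rw [hψ₀, sub_self])
    have h₁ := hO.disp_eq_zero hρ
    have h₂ := congrFun hxy₀ i
    rw [← hρψ, dispParikh_parikh, Pi.add_apply, h₁] at h₂
    simp only [toInt] at h₂
    exact hi ⟨hO, by omega⟩
  refine staysNonneg_pumped hA (x₀ := x₀) (y₀ := y₀)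
    (fun h => hus.mono (Set.singleton_subset_iff.2 ⟨h, fun h' => hi ⟨h', h⟩⟩))
    (fun h => hup i ⟨h, fun h' => hi ⟨h', h⟩⟩)
    (fun h => hvs.mono (Set.singleton_subset_iff.2 ⟨h, horth' h⟩))
    (fun h => hvp i ⟨h, horth' h⟩) hdw hdπ hR' hcw hcv hcπ hc1 ?_
  simp [toInt, mul_assoc]

end VASS

/-! ### Walks in the components and assembly of the witness -/

namespace CGS

variable {D : ℕ} {ξ : CGS D} {a b : Fin D → ℕ}

open VASS

/-- The homogeneous equations, the trivial solution included. -/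
structure IsHomogeneous (m : ξ.Assignment) : Prop where
  bdry : ∀ j, (ξ.comp j).bdry (m.psi j) = 0
  disp : ∀ j, toInt (m.x j) + (ξ.comp j).dispParikh (m.psi j) = toInt (m.y j)
  conn : ∀ j : Fin ξ.k, m.y j.castSucc = m.x j.succ
  start : m.x 0 = 0
  finish : m.y (Fin.last ξ.k) = 0

theorem toInt_add (x y : Fin D → ℕ) : toInt (x + y) = toInt x + toInt y := by
  ext i; simp [toInt]

theorem toInt_smul (c : ℕ) (x : Fin D → ℕ) : toInt (c • x) = (c : ℤ) • toInt x := by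
  ext i; simp [toInt]

variable (ξ) in
-- The trivial solution is admitted because the set of minimal homogeneous solutions may be empty,
-- in which case the sum is zero.
theorem isHomogeneous_homSum : IsHomogeneous ξ.homSum := by
  classical
  refine Finset.sum_induction (fun m => m) IsHomogeneous (fun m m' h h' => ?_) ?_ fun m hm => ?_
  · refine ⟨fun j => ?_, fun j => ?_, fun j => ?_, ?_, ?_⟩
    · change (ξ.comp j).bdry (m.psi j + m'.psi j) = 0
      rw [bdry_add, h.bdry, h'.bdry, add_zero]
    · change toInt (m.x j + m'.x j) + (ξ.comp j).dispParikh (m.psi j + m'.psi j) =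
        toInt (m.y j + m'.y j)
      rw [dispParikh_add, toInt_add, toInt_add, ← h.disp, ← h'.disp]
      abel
    · change m.y _ + m'.y _ = m.x _ + m'.x _
      rw [h.conn, h'.conn]
    · change m.x 0 + m'.x 0 = 0
      rw [h.start, h'.start, add_zero]
    · change m.y _ + m'.y _ = 0
      rw [h.finish, h'.finish, add_zero]
  · refine ⟨fun j => ?_, fun j => ?_, fun j => rfl, rfl, rfl⟩
    · change (ξ.comp j).bdry 0 = 0
      simp [VASS.bdry]
    · change toInt 0 + (ξ.comp j).dispParikh 0 = toInt 0
      simp [dispParikh]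
  · have h : ξ.IsHomSolution m := by
      have : m ∈ ξ.homBase := by simpa using hm
      exact this.1
    exact ⟨h.euler, h.disp, h.conn, h.start, h.finish⟩

/-- A linear component admits a walk for every solution plus a homogeneous solution. -/
theorem IsSolution.exists_walk_of_isLinear {n o : ξ.Assignment} (hn : ξ.IsSolution a b n)
    (ho : IsHomogeneous o) (N : ℕ) {j : Fin (ξ.k + 1)} (hl : (ξ.comp j).IsLinear) :
    ∃ π, (ξ.comp j).IsPath (ξ.comp j).entry π (ξ.comp j).exit ∧
      parikh π = n.psi j + N • o.psi j ∧
      (ξ.comp j).StaysNonneg Set.univ (toInt (n.x j + N • o.x j)) π := by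
  have hlap := hl.isLap_lap
  let e₀ : (ξ.comp j).Trans := ⟨0, hl.2.2.1⟩
  have hn0 : (ξ.comp j).bdry (n.psi j) = 0 := by
    have := hn.euler j
    rw [← hl.1, sub_self] at this
    exact this
  have hcn := hl.2.eq_of_bdry_eq_zero hn0
  have hco := hl.2.eq_of_bdry_eq_zero (ho.bdry j)
  have hψ : n.psi j + N • o.psi j = (n.psi j e₀ + N * o.psi j e₀) • (1 : (ξ.comp j).Trans → ℕ) := by
    ext e
    simp [hcn e e₀, hco e e₀]
  have hdo : toInt (o.x j) + (o.psi j e₀ : ℤ) • (ξ.comp j).disp (ξ.comp j).lap = toInt (o.y j) := by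
    have hd := ho.disp j
    have h1 : o.psi j = o.psi j e₀ • (1 : (ξ.comp j).Trans → ℕ) := by
      ext e
      simp [hco e e₀]
    rw [h1, dispParikh_smul, ← hlap.parikh_eq, dispParikh_parikh] at hd
    exact hd
  refine ⟨power (ξ.comp j).lap (n.psi j e₀ + N * o.psi j e₀), ?_, ?_, staysNonneg_power ?_ ?_⟩
  · have := hlap.1.power (n.psi j e₀ + N * o.psi j e₀)
    rwa [← hl.1]
  · rw [parikh_power, hlap.parikh_eq, hψ]
  · refine staysNonneg_of_le (hn.firstLap j hl _ hlap) fun i _ => ?_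
    simp only [toInt, Pi.add_apply, Pi.smul_apply, smul_eq_mul]
    push_cast
    have : (0 : ℤ) ≤ N * o.x j i := by positivity
    linarith
  -- The last lap now starts exactly $N\mathbf y_j^{o}\ge0$ higher than the last lap of `n`, by
  -- `hdo`.
  · refine staysNonneg_of_le (hn.lastLap j hl _ hlap e₀) fun i _ => ?_
    have h := congrFun hdo i
    have h0 : (0 : ℤ) ≤ N * o.y j i := by positivity
    simp only [toInt, Pi.add_apply, Pi.smul_apply, smul_eq_mul] at *
    rw [← h] at h0
    push_cast
    linarith

theorem rackoff_instSize_le (j : Fin (ξ.k + 1)) (J : Finset (Fin D)) :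
    rackoff (ξ.comp j).numStates (2 ^ ξ.instSize a b) (2 ^ ξ.instSize a b ^ 16 + 1) J.card ≤
      2 ^ ξ.instSize a b ^ (17 + 5 * D) := by
  have h2 := ξ.two_le_instSize a b
  have hJ : J.card ≤ D := by simpa using J.card_le_univ
  refine exp_mono h2 (rackoff_le (c := 17) h2 ?_ ?_ ?_ J.card (hJ.trans (ξ.dim_le_instSize a b)))
    (by omega)
  · exact exp_mono h2 (le_exp (a := 1) (by simpa using ξ.numStates_le a b j)) (by norm_num)
  · exact exp_mono h2 (a := 1) (by simp) (by norm_num)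
  · exact exp_add h2 le_rfl ((by norm_num : 1 ≤ 2).trans (two_le_exp h2 16))

/-- A pumping path covers $\mathbf x_j+\mathbf 1$ on the relevant indices, so Rackoff's theorem
applies with a target bounded through the size of the minimal solution. -/
theorem ForwardPumpable.exists_short {m : ξ.Assignment} {j : Fin (ξ.k + 1)}
    (h : ξ.ForwardPumpable m j) (hm : ∀ i, m.x j i ≤ 2 ^ ξ.instSize a b ^ 16) :
    ∃ u, (ξ.comp j).IsPath (ξ.comp j).entry u (ξ.comp j).entry ∧
      (ξ.comp j).StaysNonneg (ξ.entryIdx j) (toInt (m.x j)) u ∧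
      (∀ i ∈ ξ.entryIdx j, 1 ≤ (ξ.comp j).disp u i) ∧
      u.length ≤ 2 ^ ξ.instSize a b ^ (17 + 5 * D) := by
  classical
  obtain ⟨π, r, ⟨hπ, rfl, hs⟩, hr⟩ := h
  obtain ⟨u, hu, hlen⟩ := Covers.exists_short (B := 2 ^ ξ.instSize a b ^ 16 + 1)
    (ξ.abs_label_le a b j) (t := fun i => toInt (m.x j) i + 1)
    (fun i => by have := hm i; simp only [toInt]; exact_mod_cast Nat.add_le_add_right this 1)
    (ξ.entryIdx j).toFinset (p := (ξ.comp j).entry) (q := (ξ.comp j).entry)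
    (r := toInt (m.x j)) (π := π) ⟨hπ, by simpa using hs, by simpa using hr⟩
  refine ⟨u, hu.isPath, by simpa using hu.stays, fun i hi => ?_,
    hlen.trans (rackoff_instSize_le j _)⟩
  have := hu.le i (by simpa using hi)
  simp only [Pi.add_apply] at this
  linarith

/-- This is the covering argument in the reversed graph, started from $\mathbf y_j$. -/
theorem BackwardPumpable.exists_short {m : ξ.Assignment} {j : Fin (ξ.k + 1)}
    (h : ξ.BackwardPumpable m j) (hm : ∀ i, m.y j i ≤ 2 ^ ξ.instSize a b ^ 16) :
    ∃ v, (ξ.comp j).IsPath (ξ.comp j).exit v (ξ.comp j).exit ∧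
      (ξ.comp j).StaysNonneg (ξ.exitIdx j) (toInt (m.y j) - (ξ.comp j).disp v) v ∧
      (∀ i ∈ ξ.exitIdx j, (ξ.comp j).disp v i ≤ -1) ∧
      v.length ≤ 2 ^ ξ.instSize a b ^ (17 + 5 * D) := by
  classical
  obtain ⟨π, r, ⟨hπ, hy, hs⟩, hr⟩ := h
  have hs' := hs.rev
  rw [← hy] at hs'
  obtain ⟨σ, hσ, hlen⟩ := Covers.exists_short (G := (ξ.comp j).rev) (B := 2 ^ ξ.instSize a b ^ 16 + 1)
    (A := 2 ^ ξ.instSize a b)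
    (fun e i => by simpa using ξ.abs_label_le a b j e i) (t := fun i => toInt (m.y j) i + 1)
    (fun i => by have := hm i; simp only [toInt]; exact_mod_cast Nat.add_le_add_right this 1)
    (ξ.exitIdx j).toFinset (p := (ξ.comp j).exit) (q := (ξ.comp j).exit)
    (r := toInt (m.y j)) (π := π.reverse) ⟨isPath_rev.2 hπ, by simpa using hs', fun i hi => by
      have := hr i (by simpa using hi)
      have hyi := congrFun hy i
      rw [disp_rev]
      simp only [Pi.add_apply, Pi.neg_apply] at *
      linarith⟩
  obtain ⟨v, rfl⟩ : ∃ v : List (ξ.comp j).Trans, σ = v.reverse := ⟨σ.reverse, σ.reverse_reverse.symm⟩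
  refine ⟨v, isPath_rev.1 hσ.isPath, staysNonneg_of_rev ?_, fun i hi => ?_, ?_⟩
  · have := hσ.stays
    rw [sub_add_cancel]
    simpa using this
  · have := hσ.le i (by simpa using hi)
    rw [disp_rev] at this
    simp only [Pi.add_apply, Pi.neg_apply] at this
    linarith
  · rw [← List.length_reverse (as := v)]
    exact hlen.trans (rackoff_instSize_le j _)

/-- The walks in all components, for a suitable multiple of the homogeneous solution. -/
theorem exists_component_walks {n : ξ.Assignment} (hn : n ∈ ξ.minSolutions a b)
    (hcomp : ∀ j, (ξ.comp j).IsLinear ∨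
      (ξ.CompUnbounded j ∧ ξ.Pumpable n j ∧ ξ.OrthogonallySimplified n j)) :
    ∃ N ≤ 2 ^ ξ.instSize a b ^ (60 + 10 * D), ∀ j, ∃ π,
      (ξ.comp j).IsPath (ξ.comp j).entry π (ξ.comp j).exit ∧
      parikh π = n.psi j + N • ξ.homSum.psi j ∧
      (ξ.comp j).StaysNonneg Set.univ (toInt (n.x j + N • ξ.homSum.x j)) π := by
  set S := ξ.instSize a b with hS
  have h2 : 2 ≤ S := ξ.two_le_instSize a b
  have hsol := hn.1
  have hO := ξ.isHomogeneous_homSum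
  have hnB := ξ.minSolutions_le a b hn
  have hOB := ξ.homSum_le a b
  set k := 25 + 5 * D with hk
  set L := 2 ^ S ^ (17 + 5 * D) with hL
  have hAk : 2 ^ S ≤ 2 ^ S ^ k := exp_mono h2 (a := 1) (by simp) (by omega)
  have h1 : ∀ c, 1 ≤ 2 ^ S ^ c := fun c => Nat.one_le_two_pow
  -- `R` and `c` are computed from bounds common to all components, since the entry and exit
  -- locations must be shifted by the same multiple everywhere.
  set R := (2 ^ S + 1) * (L + L) + 1 with hRdef
  have hR : R ≤ 2 ^ S ^ (k + 3) :=
    exp_add h2 (exp_mul h2 (exp_add h2 hAk (h1 _)) (exp_add h2 (exp_mono h2 le_rfl (by omega))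
      (exp_mono h2 le_rfl (by omega)))) (h1 _)
  have hsum : ∀ j {ψ : (ξ.comp j).Trans → ℕ}, (∀ e, ψ e ≤ 2 ^ S ^ k) → ∑ e, ψ e ≤ 2 ^ S ^ (k + 1) := by
    intro j ψ h
    refine (Finset.sum_le_card_nsmul _ _ _ fun e _ => h e).trans ?_
    simp only [Finset.card_univ, Fintype.card_fin, smul_eq_mul]
    exact exp_mul h2 (exp_mono h2 (le_exp (a := 1) (by simpa using ξ.numTrans_le a b j))
      (by omega)) le_rfl
  set c := 2 ^ S * (R * 2 ^ S ^ (k + 1)) + 2 ^ S * 2 ^ S ^ (k + 1) + 1 with hcdef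
  have hc : c ≤ 2 ^ S ^ (k + 7) :=
    exp_add h2 (exp_add h2 (exp_mul (a := k + 4) h2 (exp_mono h2 hAk (by omega))
      (exp_mul h2 hR (exp_mono h2 le_rfl (by omega))))
      (exp_mul (a := k + 4) h2 (exp_mono h2 hAk (by omega)) (exp_mono h2 le_rfl (by omega))))
      (h1 _)
  refine ⟨c * R, exp_mono h2 (exp_mul h2 hc (exp_mono h2 hR (by omega))) (by omega), fun j => ?_⟩
  rcases hcomp j with hl | ⟨hunb, ⟨hf, hb⟩, horth⟩
  · exact hsol.exists_walk_of_isLinear hO _ hl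
  obtain ⟨u, hu, hus, hup, hul⟩ := hf.exists_short (a := a) (b := b) fun i => hnB (Var.x j i)
  obtain ⟨v, hv, hvs, hvp, hvl⟩ := hb.exists_short (a := a) (b := b) fun i => hnB (Var.y j i)
  refine (ξ.comp j).stronglyConnected.exists_pumped_walk (ξ.abs_label_le a b j) (hsol.euler j)
    (hsol.pos j) (hsol.disp j) (hO.bdry j) hunb (hO.disp j) hu hv hus hup hvs hvp
    (fun i hi hi' o π hπ => horth i hi hi' o π hπ) ?_ ?_
  · rw [hRdef]
    gcongr
  · rw [hcdef]
    have h₃ := hsum j (ψ := ξ.homSum.psi j) fun e =>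
      exp_mono h2 (hOB (Var.psi j e)) (by omega)
    have h₄ := hsum j (ψ := n.psi j) fun e => exp_mono h2 (hnB (Var.psi j e)) (by omega)
    gcongr

end CGS

open VASS CGS in
theorem mainTheorem5 (D : ℕ) :
    ∃ P : Polynomial ℕ, ∀ (ξ : CGS D) (a b : Fin D → ℕ), ξ.Normal a b →
      ∃ w : ξ.Witness a b, w.length ≤ 2 ^ P.eval (ξ.instSize a b) := by
  -- The multiple `N` has exponent at most $60+10D$; the remaining units absorb the multiplicities
  -- of $\mathbf n+N\mathbf O$, their sums over edges and components, and the connecting edges.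
  refine ⟨Polynomial.X ^ (70 + 10 * D), ?_⟩
  rintro ξ a b ⟨-, n, hn, hcomp⟩
  obtain ⟨N, hN, h⟩ := exists_component_walks hn hcomp
  choose π hπ hψ hs using h
  set O := ξ.homSum
  have hO := ξ.isHomogeneous_homSum
  have hsol := hn.1
  have hdisp : ∀ j, toInt (n.y j + N • O.y j) = toInt (n.x j + N • O.x j) +
      (ξ.comp j).disp (π j) := by
    intro j
    rw [← dispParikh_parikh, hψ, dispParikh_add, dispParikh_smul, toInt_add, toInt_add, toInt_smul,
      toInt_smul, ← hsol.disp j, ← hO.disp j, smul_add]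
    abel
  refine ⟨⟨fun j => n.x j + N • O.x j, fun j => n.y j + N • O.y j, π,
    fun j => ⟨hπ j, hdisp j, hs j⟩, ?_, fun j => ?_, ?_⟩, ?_⟩
  · rw [hsol.start, hO.start, smul_zero, add_zero]
  · rw [toInt_add, toInt_add, ← hsol.conn j, hO.conn j]
    abel
  · rw [hsol.finish, hO.finish, smul_zero, add_zero]
  set S := ξ.instSize a b with hS
  have h2 : 2 ≤ S := ξ.two_le_instSize a b
  rw [Polynomial.eval_pow, Polynomial.eval_X]
  set k := 60 + 10 * D with hk
  have hS1 : S ≤ 2 ^ S ^ 1 := le_exp (by simp)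
  have hlen : ∀ j, (π j).length ≤ 2 ^ S ^ (k + 3) := by
    intro j
    rw [length_eq_sum_parikh, hψ]
    refine (Finset.sum_le_card_nsmul _ _ (2 ^ S ^ (k + 2)) fun e _ => ?_).trans ?_
    · exact exp_add h2 (exp_mono h2 (ξ.minSolutions_le a b hn (Var.psi j e)) (by omega))
        (exp_mul h2 hN (exp_mono h2 (ξ.homSum_le a b (Var.psi j e)) (by omega)))
    · simp only [Finset.card_univ, Fintype.card_fin, smul_eq_mul]
      exact exp_mul h2 (exp_mono h2 ((ξ.numTrans_le a b j).trans hS1) (by omega)) le_rfl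
  have hsum : ∑ j, (π j).length ≤ 2 ^ S ^ (k + 4) := by
    refine (Finset.sum_le_card_nsmul _ _ _ fun j _ => hlen j).trans ?_
    simp only [Finset.card_univ, Fintype.card_fin, smul_eq_mul]
    exact exp_mul h2 (exp_mono h2 ((ξ.k_lt_instSize a b).trans hS1) (by omega)) le_rfl
  have hk' : ξ.k ≤ 2 ^ S ^ (k + 4) :=
    exp_mono h2 (((Nat.le_succ _).trans (ξ.k_lt_instSize a b)).trans hS1) (by omega)
  exact exp_mono h2 (exp_add h2 hsum hk') (by omega)
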